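/- Consider layers $0,\dots,K$ with altitudes $h_k\ge 0$ ($h_0=0$), transmission powers $P_k>0$, association biases $B_k>0$, receiver and transmitter densities $\lambda_{k,\mathrm{Rx}},\lambda_{k,\mathrm{Tx}}\ge 0$, and put $h_{ik}=|h_i-h_k|$. The receivers and the transmitters of each layer $k$ have horizontal positions forming homogeneous Poisson point processes on $\mathbb R^2$ of these densities, all independent. A link of length $x$ (including the altitude difference) between a receiver of layer $i$ and a transmitter of layer $k$ is, independently of everything else given the positions, in channel state $\mathrm L$ (line of sight) with probability $\rho^{(\mathrm L)}_{ik}(x)\in[0,1]$, a measurable function of $x$, and in state $\mathrm N$ with probability $\rho^{(\mathrm N)}_{ik}(x)=1-\rho^{(\mathrm L)}_{ik}(x)$. State $c$ has pathloss exponent $\alpha^{(c)}>0$ and a channel gain $G^{(c)}\sim\Gamma(m^{(c)},1/m^{(c)})$ (shape, scale), $m^{(c)}>0$, independent over links and of everything else. Let $\tau=oa$ be an association rule. For $o=\mathrm r$ (receiver-oriented) a typical receiver of layer $i$ at the origin selects a transmitter; for $o=\mathrm t$ (transmitter-oriented) a typical transmitter of layer $j$ at the origin selects a receiver. Among the candidates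 in all layers, with layer $k$, link distance $x$ and link state $c$, it selects the one maximizing $B_kx^{-1}$ for $a=\mathrm n$ (nearest), and $B_kx^{-\alpha^{(c)}}$ for $a=\mathrm s$ (strongest). Let $\varepsilon^{(c)}_{ij,\tau}(y)$ be the event that the main link so established joins a receiver of layer $i$ and a transmitter of layer $j$, has channel state $c$ and has length $y$. Let $$I^{(c_o)}_{ik}=\sum P_k\,G^{(c_o)}\,x^{-\alpha^{(c_o)}}$$ be the interference at the receiver of the main link, where the sum is over all transmitters of layer $k$, other than the transmitter of the main link, whose link to this receiver is in state $c_o$, and $x$ is the length and $G^{(c_o)}$ the gain of that link. Then for all $i,j,k\in\{0,\dots,K\}$ and all $c,c_o\in\{\mathrm L,\mathrm N\}$, for almost every $y$ with respect to the law of the main link length given that the main link is of type $(i,j,c)$, and for all $s\ge 0$, the conditional Laplace transform of the interference is $$\mathcal L_{I^{(c_o)}_{ik}\mid\varepsilon^{(c)}_{ij,\tau}(y)}(s)=\exp\left[-2\pi\lambda_{k,\mathrm{Tx}}\int_{\max(\chi(y),h_{ik})}^{\infty}x\,\rho^{(c_o)}_{ik}(x)\left(1-\left(1+\frac{sP_kx^{-\alpha^{(c_o)}}}{m^{(c_o)}}\right)^{-m^{(c_o)}}\right)dx\right],$$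 where $\chi(y)=0$ for $o=\mathrm t$, while for $o=\mathrm r$ $$\chi(y)=\frac{yB_k}{B_j}\ \text{ if } a=\mathrm n,\qquad \chi(y)=\left(\frac{y^{\alpha^{(c)}}B_k}{B_j}\right)^{1/\alpha^{(c_o)}}\ \text{ if } a=\mathrm s.$$ Here the interference and the integral take values in $[0,\infty]$, with $e^{-\infty}=0$ and $0\cdot\infty=0$. -/

import Mathlib

open MeasureTheory ProbabilityTheory Set
open scoped NNReal ENNReal

noncomputable section

namespace MAN

/-! ### Poisson point processes

A point process on `E` is given by its (random, possibly infinite) number of points `N` and an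
enumeration `X 0, X 1, …` of them; the values `X n` with `N ≤ n` are irrelevant. -/

/-- Number of points in `B` (points are counted with multiplicity). -/
def count {Ω E : Type*} (N : Ω → ℕ∞) (X : ℕ → Ω → E) (B : Set E) (ω : Ω) : ℕ∞ :=
  Set.encard {n : ℕ | (n : ℕ∞) < N ω ∧ X n ω ∈ B}

/-- `(N, X)` is, under the probability measure `μ`, a Poisson point process with intensity
measure `ν`: the number of points in a set `B` of finite `ν`-measure is Poisson with mean `ν B`, and
the numbers of points in pairwise disjoint sets are independent. -/
structure IsPoissonProcess {Ω E : Type*} [MeasurableSpace Ω] [MeasurableSpace E]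
    (N : Ω → ℕ∞) (X : ℕ → Ω → E) (ν : Measure E) (μ : Measure Ω) : Prop where
  measurable_number : Measurable N
  measurable_point : ∀ n, Measurable (X n)
  law_count : ∀ B : Set E, MeasurableSet B → ν B < ∞ →
    μ.map (count N X B) = (poissonMeasure (ν B).toNNReal).map (fun n : ℕ => (n : ℕ∞))
  indep_count : ∀ (q : ℕ) (B : Fin q → Set E), (∀ b, MeasurableSet (B b)) → (∀ b, ν (B b) < ∞) →
    Pairwise (fun b b' => Disjoint (B b) (B b')) → iIndepFun (fun b => count N X (B b)) μ

/-! ### Parameters of a multi-layer aerial network -/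

/-- Channel environment: line of sight, non line of sight. -/
inductive Channel
  | los
  | nlos

/-- Function of a node: receiver, transmitter. -/
inductive Role
  | rx
  | tx

/-- Association subject: receiver-oriented (a receiver selects a transmitter) or
transmitter-oriented (a transmitter selects a receiver). -/
inductive Subject
  | receiver
  | transmitter

/-- Association criterion: nearest distance or strongest power. -/
inductive Criterion
  | nearest
  | strongest

/-- Deterministic parameters of a network with the layers `0, …, K`. -/
structure Params (K : ℕ) where
  /-- altitude of a layer -/
  h : Fin (K + 1) → ℝ
  /-- transmission power of a layer -/
  P : Fin (K + 1) → ℝ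
  /-- association bias of a layer -/
  B : Fin (K + 1) → ℝ
  /-- density of the receivers and of the transmitters of a layer -/
  dens : Role → Fin (K + 1) → ℝ≥0
  /-- pathloss exponents -/
  α : Channel → ℝ
  /-- Nakagami fading parameters -/
  m : Channel → ℝ
  /-- `ρLos i j x`: probability that a link of length `x` between a receiver of layer `i` and a
  transmitter of layer `j` has line of sight -/
  ρLos : Fin (K + 1) → Fin (K + 1) → ℝ → ℝ
  h_zero : h 0 = 0
  h_nonneg : ∀ k, 0 ≤ h k
  P_pos : ∀ k, 0 < P k
  B_pos : ∀ k, 0 < B k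
  α_pos : ∀ c, 0 < α c
  m_pos : ∀ c, 0 < m c
  ρLos_measurable : ∀ i j, Measurable (ρLos i j)
  ρLos_nonneg : ∀ i j x, 0 ≤ ρLos i j x
  ρLos_le_one : ∀ i j x, ρLos i j x ≤ 1

namespace Params

variable {K : ℕ} (θ : Params K)

/-- Probability of the channel environment `c`. -/
def ρ (c : Channel) (i j : Fin (K + 1)) (x : ℝ) : ℝ :=
  match c with
  | .los => θ.ρLos i j x
  | .nlos => 1 - θ.ρLos i j x

/-- Altitude difference of two layers. -/
def hdiff (i j : Fin (K + 1)) : ℝ := |θ.h i - θ.h j|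

/-- The distance `R_{j,k,a}^{(c,c₀)}(y)`. -/
def R (a : Criterion) (j k : Fin (K + 1)) (c c₀ : Channel) (y : ℝ) : ℝ :=
  match a with
  | .nearest => y * θ.B k / θ.B j
  | .strongest => (y ^ θ.α c * θ.B k / θ.B j) ^ (1 / θ.α c₀)

/-- The distance `χ_{j,k,τ}^{(c,c₀)}(y)`. -/
def χ (o : Subject) (a : Criterion) (j k : Fin (K + 1)) (c c₀ : Channel) (y : ℝ) : ℝ :=
  match o with
  | .receiver => θ.R a j k c c₀ y
  | .transmitter => 0

end Params

/-! ### The random network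

Beside the nodes of the point processes there is one typical node, whose horizontal position is the
origin: the typical receiver of layer `i` under receiver-oriented association, the typical
transmitter of layer `j` under transmitter-oriented association. -/

/-- Horizontal positions. -/
abbrev Plane : Type := EuclideanSpace ℝ (Fin 2)

/-- Index of a node of the point processes: its layer and its number in the enumeration. -/
abbrev Node (K : ℕ) : Type := Fin (K + 1) × ℕ

/-- Index of a receiver or of a transmitter; `none` is the typical node. -/
abbrev End (K : ℕ) : Type := Option (Node K)

/-- The random elements of the network. For each link, i.e. each pair of a receiver and a
transmitter, `coin` decides on its channel environment, and `gain c` is its channel gain if that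
environment is `c`. -/
structure Network (K : ℕ) (Ω : Type*) where
  /-- number of nodes of a point process -/
  number : Role → Fin (K + 1) → Ω → ℕ∞
  /-- positions of the nodes of a point process -/
  point : Role → Fin (K + 1) → ℕ → Ω → Plane
  coin : End K → End K → Ω → ℝ
  gain : Channel → End K → End K → Ω → ℝ

/-- The independent sources of randomness. -/
inductive Source (K : ℕ)
  | nodes (u : Role) (k : Fin (K + 1))
  | coin (r t : End K)
  | gain (c : Channel) (r t : End K)

namespace Network

variable {K : ℕ} {Ω : Type*}

/-- The σ-algebra generated by a source of randomness. -/
@[reducible] def sigma (X : Network K Ω) : Source K → MeasurableSpace Ω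
  | .nodes u k => MeasurableSpace.comap (X.number u k) inferInstance ⊔
      ⨆ n, MeasurableSpace.comap (X.point u k n) inferInstance
  | .coin r t => MeasurableSpace.comap (X.coin r t) inferInstance
  | .gain c r t => MeasurableSpace.comap (X.gain c r t) inferInstance

/-- The law of the network: the nodes of each layer and role form a homogeneous Poisson point process
of the given density, the coins are uniform on `[0, 1]`, the gains are Gamma distributed with shape
`m` and scale `1 / m` (rate `m`), and all of these are independent. -/
structure IsModel [MeasurableSpace Ω] (X : Network K Ω) (θ : Params K) (μ : Measure Ω) : Prop where
  poisson : ∀ u k,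
    IsPoissonProcess (X.number u k) (X.point u k) (θ.dens u k • (volume : Measure Plane)) μ
  measurable_coin : ∀ r t, Measurable (X.coin r t)
  law_coin : ∀ r t, μ.map (X.coin r t) = (volume : Measure ℝ).restrict (Icc 0 1)
  measurable_gain : ∀ c r t, Measurable (X.gain c r t)
  law_gain : ∀ c r t, μ.map (X.gain c r t) = gammaMeasure (θ.m c) (θ.m c)
  indep : iIndep X.sigma μ

variable (X : Network K Ω) (θ : Params K)

/-- The node of index `p` exists. -/
def Active (u : Role) (p : Node K) (ω : Ω) : Prop := (p.2 : ℕ∞) < X.number u p.1 ω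

/-- Layer of a node, where the typical node is in layer `i`. -/
def layer (i : Fin (K + 1)) : End K → Fin (K + 1)
  | none => i
  | some p => p.1

/-- Horizontal position of a node. -/
def pos (u : Role) : End K → Ω → Plane
  | none, _ => 0
  | some p, ω => X.point u p.1 p.2 ω

/-! In the sequel `i` is the layer of the typical receiver and `j` the layer of the typical
transmitter; only one of the two is present, according to the association subject. -/

/-- Link distance between the receiver `r` and the transmitter `t`. -/
def dist (i j : Fin (K + 1)) (r t : End K) (ω : Ω) : ℝ :=
  Real.sqrt (‖X.pos .rx r ω - X.pos .tx t ω‖ ^ 2 + θ.hdiff (layer i r) (layer j t) ^ 2)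

open Classical in
/-- Channel environment of the link between `r` and `t`; given all positions, it is line of sight
with the probability `ρLos` at the link distance, independently of the other links. -/
def channel (i j : Fin (K + 1)) (r t : End K) (ω : Ω) : Channel :=
  if X.coin r t ω < θ.ρLos (layer i r) (layer j t) (X.dist θ i j r t ω) then .los else .nlos

/-- The role of the nodes among which the typical node selects. -/
def candidateRole : Subject → Role
  | .receiver => .tx
  | .transmitter => .rx

/-- The receiver of the link between the typical node and the candidate `p`. -/
def rxEnd (o : Subject) (p : Node K) : End K :=
  match o with
  | .receiver => none
  | .transmitter => some p

/-- The transmitter of the link between the typical node and the candidate `p`. -/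
def txEnd (o : Subject) (p : Node K) : End K :=
  match o with
  | .receiver => some p
  | .transmitter => none

/-- Link distance between the typical node and the candidate `p`. -/
def candDist (o : Subject) (i j : Fin (K + 1)) (p : Node K) (ω : Ω) : ℝ :=
  X.dist θ i j (rxEnd o p) (txEnd o p) ω

/-- Channel environment between the typical node and the candidate `p`. -/
def candChannel (o : Subject) (i j : Fin (K + 1)) (p : Node K) (ω : Ω) : Channel :=
  X.channel θ i j (rxEnd o p) (txEnd o p) ω

/-- The quantity that the association rule maximizes over the candidates. -/
def score (o : Subject) (a : Criterion) (i j : Fin (K + 1)) (p : Node K) (ω : Ω) : ℝ :=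
  match a with
  | .nearest => θ.B p.1 * (X.candDist θ o i j p ω)⁻¹
  | .strongest => θ.B p.1 * X.candDist θ o i j p ω ^ (-θ.α (X.candChannel θ o i j p ω))

/-- `p` is the candidate that the typical node selects. -/
def IsAssociated (o : Subject) (a : Criterion) (i j : Fin (K + 1)) (p : Node K) (ω : Ω) : Prop :=
  X.Active (candidateRole o) p ω ∧
    ∀ q, X.Active (candidateRole o) q ω → q ≠ p → X.score θ o a i j q ω < X.score θ o a i j p ω

open Classical in
/-- The selected candidate (the maximizer), if there is one. -/
def associated (o : Subject) (a : Criterion) (i j : Fin (K + 1)) (ω : Ω) : Option (Node K) :=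
  if hp : ∃ p, X.IsAssociated θ o a i j p ω then some hp.choose else none

/-- The event that the main link is between a receiver of layer `i` and a transmitter of layer `j`
and has channel environment `c`. -/
def mainLinkEvent (o : Subject) (a : Criterion) (i j : Fin (K + 1)) (c : Channel) : Set Ω :=
  {ω | ∃ p, X.associated θ o a i j ω = some p ∧ layer i (rxEnd o p) = i ∧
    layer j (txEnd o p) = j ∧ X.candChannel θ o i j p ω = c}

/-- The main link distance (`0` if there is no main link). -/
def mainLinkDist (o : Subject) (a : Criterion) (i j : Fin (K + 1)) (ω : Ω) : ℝ :=
  match X.associated θ o a i j ω with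
  | none => 0
  | some p => X.candDist θ o i j p ω

open Classical in
/-- Interference at the receiver `r`, whose transmitter is `t`, from the other transmitters of layer
`k` in channel environment `c₀`. -/
def interferenceAt (i j k : Fin (K + 1)) (c₀ : Channel) (r t : End K) (ω : Ω) : ℝ≥0∞ :=
  ∑' n : ℕ,
    if X.Active .tx (k, n) ω ∧ some (k, n) ≠ t ∧ X.channel θ i j r (some (k, n)) ω = c₀ then
      ENNReal.ofReal (θ.P k * X.gain c₀ r (some (k, n)) ω *
        X.dist θ i j r (some (k, n)) ω ^ (-θ.α c₀))
    else 0

/-- Interference at the receiver of the main link from the transmitters of layer `k` in channel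
environment `c₀`, except the transmitter of the main link (`0` if there is no main link). -/
def interference (o : Subject) (a : Criterion) (i j k : Fin (K + 1)) (c₀ : Channel) (ω : Ω) :
    ℝ≥0∞ :=
  match X.associated θ o a i j ω with
  | none => 0
  | some p => X.interferenceAt θ i j k c₀ (rxEnd o p) (txEnd o p) ω

/-- For each `y`, the conditional law of the interference given that the main link is between a
receiver of layer `i` and a transmitter of layer `j`, has channel environment `c`, and has length
`y`: a regular conditional distribution, unique up to a null set of `y`. -/
def condInterferenceLaw [MeasurableSpace Ω] (μ : Measure Ω) [IsProbabilityMeasure μ]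
    (o : Subject) (a : Criterion) (i j k : Fin (K + 1)) (c c₀ : Channel) : Kernel ℝ ℝ≥0∞ :=
  condDistrib (X.interference θ o a i j k c₀) (X.mainLinkDist θ o a i j)
    (μ[|X.mainLinkEvent θ o a i j c])

end Network

/-- `exp (-u)` for `0 ≤ u ≤ ∞`, with `exp (-∞) = 0`. -/
def expNeg (u : ℝ≥0∞) : ℝ≥0∞ := EReal.exp (-(u : EReal))

/-- Laplace transform at `s ≥ 0` of a law on `[0, ∞]`. -/
def laplace (κ : Measure ℝ≥0∞) (s : ℝ≥0) : ℝ≥0∞ := ∫⁻ u, expNeg (s * u) ∂κ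

end MAN

end

namespace MAN
open Filter Topology

/-! ### The function `expNeg` -/

@[simp] lemma expNeg_zero : expNeg 0 = 1 := by simp [expNeg]

@[simp] lemma expNeg_top : expNeg ∞ = 0 := by simp [expNeg]

lemma expNeg_eq_inv (u : ℝ≥0∞) : expNeg u = (EReal.exp (u : EReal))⁻¹ := by
  rw [expNeg, EReal.exp_neg]

lemma expNeg_add (u v : ℝ≥0∞) : expNeg (u + v) = expNeg u * expNeg v := by
  rw [expNeg_eq_inv, expNeg_eq_inv, expNeg_eq_inv, EReal.coe_ennreal_add, EReal.exp_add,
    ENNReal.mul_inv]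
  · left; simp
  · right; simp

lemma expNeg_strictAnti : StrictAnti expNeg := fun u v h => by
  simpa [expNeg] using h

lemma expNeg_antitone : Antitone expNeg := expNeg_strictAnti.antitone

lemma expNeg_le_one (u : ℝ≥0∞) : expNeg u ≤ 1 := by
  simpa using expNeg_antitone (zero_le (a := u))

lemma expNeg_ne_top (u : ℝ≥0∞) : expNeg u ≠ ∞ :=
  ne_top_of_le_ne_top ENNReal.one_ne_top (expNeg_le_one u)

@[fun_prop]
lemma continuous_expNeg : Continuous expNeg :=
  ENNReal.continuous_exp.comp (continuous_neg.comp continuous_coe_ennreal_ereal)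

@[fun_prop]
lemma measurable_expNeg : Measurable expNeg := continuous_expNeg.measurable

lemma expNeg_ofReal {r : ℝ} (hr : 0 ≤ r) :
    expNeg (ENNReal.ofReal r) = ENNReal.ofReal (Real.exp (-r)) := by
  rw [expNeg, EReal.coe_ennreal_ofReal, max_eq_left hr, ← EReal.coe_neg, EReal.exp_coe]

lemma expNeg_eq_ofReal {u : ℝ≥0∞} (hu : u ≠ ∞) :
    expNeg u = ENNReal.ofReal (Real.exp (-u.toReal)) := by
  rw [← expNeg_ofReal ENNReal.toReal_nonneg, ENNReal.ofReal_toReal hu]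

lemma expNeg_natCast (n : ℕ) : expNeg n = ENNReal.ofReal (Real.exp (-n)) := by
  rw [← expNeg_ofReal n.cast_nonneg, ENNReal.ofReal_natCast]

lemma expNeg_sum {ι : Type*} (s : Finset ι) (f : ι → ℝ≥0∞) :
    expNeg (∑ i ∈ s, f i) = ∏ i ∈ s, expNeg (f i) := by
  classical
  induction s using Finset.induction_on with
  | empty => simp
  | insert i s hi ih => rw [Finset.sum_insert hi, Finset.prod_insert hi, expNeg_add, ih]

/-- `-log w`, as an element of `[0, ∞]`. -/
noncomputable def negLog (w : ℝ≥0∞) : ℝ≥0∞ := (-ENNReal.log w).toENNReal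

@[fun_prop]
lemma measurable_negLog : Measurable negLog :=
  measurable_ereal_toENNReal.comp ENNReal.measurable_log.neg

lemma expNeg_negLog {w : ℝ≥0∞} (hw : w ≤ 1) : expNeg (negLog w) = w := by
  have h : 0 ≤ -ENNReal.log w := by
    rw [EReal.le_neg, neg_zero]
    simpa using hw
  rw [expNeg, negLog, EReal.coe_toENNReal h, neg_neg, ENNReal.exp_log]

lemma tendsto_expNeg_tsum {ι : Type*} (f : ι → ℝ≥0∞) :
    Tendsto (fun s : Finset ι => expNeg (∑ i ∈ s, f i)) atTop (𝓝 (expNeg (∑' i, f i))) :=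
  (continuous_expNeg.tendsto _).comp ENNReal.summable.hasSum

/-- Integration of a function of two independent random variables. -/
lemma lintegral_of_indepFun {Ω β γ : Type*} [MeasurableSpace Ω] [MeasurableSpace β]
    [MeasurableSpace γ] {μ : Measure Ω} [IsProbabilityMeasure μ] {Y : Ω → β} {M : Ω → γ}
    (hY : Measurable Y) (hM : Measurable M) (h : IndepFun Y M μ) {f : β × γ → ℝ≥0∞}
    (hf : Measurable f) :
    ∫⁻ ω, f (Y ω, M ω) ∂μ = ∫⁻ ω, ∫⁻ y, f (Y ω, y) ∂(μ.map M) ∂μ := by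
  have : IsProbabilityMeasure (μ.map M) := Measure.isProbabilityMeasure_map hM.aemeasurable
  have : IsProbabilityMeasure (μ.map Y) := Measure.isProbabilityMeasure_map hY.aemeasurable
  rw [← lintegral_map hf (hY.prodMk hM), (indepFun_iff_map_prod_eq_prod_map_map hY.aemeasurable
    hM.aemeasurable).1 h, lintegral_prod _ hf.aemeasurable,
    lintegral_map hf.lintegral_prod_right' hY]

end MAN

namespace MAN
open Filter Topology

/-! ### The Laplace functional of a Poisson process -/

section Poisson

variable {Ω E : Type*} {N : Ω → ℕ∞} {X : ℕ → Ω → E}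

lemma tsum_ite_mem_eq_count (B : Set E) (τ : ℝ≥0∞) (ω : Ω) :
    ∑' n : ℕ, (if (n : ℕ∞) < N ω then B.indicator (fun _ => τ) (X n ω) else 0) =
      (count N X B ω : ℝ≥0∞) * τ := by
  rw [count, ← ENNReal.tsum_set_const, tsum_subtype {n : ℕ | (n : ℕ∞) < N ω ∧ X n ω ∈ B}
    (fun _ => τ)]
  refine tsum_congr fun n => ?_
  by_cases h : (n : ℕ∞) < N ω <;> by_cases h' : X n ω ∈ B <;> simp [h, h']

lemma one_sub_expNeg_sum_indicator {ι : Type*} [Fintype ι] {B : ι → Set E}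
    (hd : Pairwise fun b b' => Disjoint (B b) (B b')) (τ : ι → ℝ≥0∞) (x : E) :
    1 - expNeg (∑ b, (B b).indicator (fun _ => τ b) x) =
      ∑ b, (B b).indicator (fun _ => 1 - expNeg (τ b)) x := by
  classical
  by_cases hx : ∃ b, x ∈ B b
  · obtain ⟨b, hb⟩ := hx
    have hne : ∀ b' ≠ b, x ∉ B b' := fun b' hb' hx' =>
      Set.disjoint_left.1 (hd hb') hx' hb
    rw [Finset.sum_eq_single b (fun b' _ hb' => by simp [hne b' hb']) (by simp),
      Finset.sum_eq_single b (fun b' _ hb' => by simp [hne b' hb']) (by simp)]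
    simp [hb]
  · push Not at hx
    simp [hx]

variable [MeasurableSpace Ω] [MeasurableSpace E] {μ : Measure Ω} {ν : Measure E}

lemma measurable_tsum_active {ι : Type*} [Countable ι] {E : Type*} [MeasurableSpace E]
    {a : ι → Ω → Prop} {Z : ι → Ω → E} (ha : ∀ p, MeasurableSet {ω | a p ω})
    (hZ : ∀ p, Measurable (Z p)) [∀ p ω, Decidable (a p ω)] {v : E → ℝ≥0∞} (hv : Measurable v) :
    Measurable fun ω => ∑' p, if a p ω then v (Z p ω) else 0 :=
  Measurable.tsum fun p =>
    Measurable.ite (ha p) (hv.comp (hZ p)) measurable_const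

lemma measurable_count (hN : Measurable N) (hX : ∀ n, Measurable (X n)) {B : Set E}
    (hB : MeasurableSet B) : Measurable (count N X B) := by
  have h : Measurable fun ω => (count N X B ω : ℝ≥0∞) := by
    have := measurable_tsum_active (a := fun (n : ℕ) ω => (n : ℕ∞) < N ω) (Z := X)
      (fun n : ℕ => hN (MeasurableSet.of_discrete (s := Ioi (n : ℕ∞)))) hX
      (measurable_const.indicator hB : Measurable (B.indicator fun _ => (1 : ℝ≥0∞)))
    simpa only [tsum_ite_mem_eq_count, mul_one] using this
  refine measurable_to_countable' fun m => ?_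
  have : count N X B ⁻¹' {m} = (fun ω => (count N X B ω : ℝ≥0∞)) ⁻¹' {(m : ℝ≥0∞)} := by
    ext ω; simp
  rw [this]
  exact h (measurableSet_singleton _)

lemma lintegral_expNeg_mul_poisson (r : ℝ≥0) (τ : ℝ≥0∞) :
    ∫⁻ n, expNeg ((n : ℝ≥0∞) * τ) ∂(poissonMeasure r) = expNeg ((1 - expNeg τ) * r) := by
  have hp : ∀ n : ℕ, expNeg ((n : ℝ≥0∞) * τ) = expNeg τ ^ n := fun n => by
    rw [← nsmul_eq_mul, ← Finset.card_range n, ← Finset.sum_const, expNeg_sum,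
      Finset.prod_const]
  obtain ⟨w, hw0, hw1, hw⟩ : ∃ w : ℝ, 0 ≤ w ∧ w ≤ 1 ∧ expNeg τ = ENNReal.ofReal w :=
    ⟨(expNeg τ).toReal, ENNReal.toReal_nonneg,
      ENNReal.toReal_le_of_le_ofReal zero_le_one (by simpa using expNeg_le_one τ),
      (ENNReal.ofReal_toReal (expNeg_ne_top τ)).symm⟩
  have hs := (NormedSpace.expSeries_div_hasSum_exp ((r : ℝ) * w)).mul_left (Real.exp (-r))
  simp_rw [hp, hw]
  rw [poissonMeasure, lintegral_sum_measure]
  simp only [lintegral_smul_measure, lintegral_dirac, smul_eq_mul]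
  calc ∑' n : ℕ, ENNReal.ofReal (Real.exp (-r) * r ^ n / n.factorial) * ENNReal.ofReal w ^ n
      = ∑' n : ℕ, ENNReal.ofReal (Real.exp (-r) * ((r * w) ^ n / n.factorial)) := by
        refine tsum_congr fun n => ?_
        rw [← ENNReal.ofReal_pow hw0, ← ENNReal.ofReal_mul (by positivity), mul_pow]
        congr 1; ring
    _ = ENNReal.ofReal (Real.exp (-((1 - w) * r))) := by
        rw [← ENNReal.ofReal_tsum_of_nonneg (fun n => by positivity) hs.summable, hs.tsum_eq,
          ← Real.exp_eq_exp_ℝ, ← Real.exp_add]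
        congr 2; ring
    _ = _ := by
        rw [← expNeg_ofReal (mul_nonneg (by linarith) r.coe_nonneg),
          ENNReal.ofReal_mul (by linarith), ENNReal.ofReal_coe_nnreal, ENNReal.ofReal_sub _ hw0,
          ENNReal.ofReal_one]

lemma IsPoissonProcess.lintegral_expNeg_count (h : IsPoissonProcess N X ν μ) {B : Set E}
    (hB : MeasurableSet B) (hfin : ν B < ∞) (τ : ℝ≥0∞) :
    ∫⁻ ω, expNeg (count N X B ω * τ) ∂μ = expNeg ((1 - expNeg τ) * ν B) := by
  have hm := measurable_count h.measurable_number h.measurable_point hB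
  calc ∫⁻ ω, expNeg (count N X B ω * τ) ∂μ
      = ∫⁻ n : ℕ∞, expNeg ((n : ℝ≥0∞) * τ) ∂(μ.map (count N X B)) := by
        rw [lintegral_map (Measurable.of_discrete) hm]
    _ = _ := by
        rw [h.law_count B hB hfin, lintegral_map Measurable.of_discrete Measurable.of_discrete]
        simpa [ENNReal.coe_toNNReal hfin.ne] using
          lintegral_expNeg_mul_poisson (ν B).toNNReal τ

lemma IsPoissonProcess.laplaceFunctional_sum_indicator (h : IsPoissonProcess N X ν μ) {q : ℕ}
    {B : Fin q → Set E} (hB : ∀ b, MeasurableSet (B b)) (hfin : ∀ b, ν (B b) < ∞)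
    (hd : Pairwise fun b b' => Disjoint (B b) (B b')) (τ : Fin q → ℝ≥0∞) :
    ∫⁻ ω, expNeg (∑' n : ℕ, if (n : ℕ∞) < N ω then
      ∑ b, (B b).indicator (fun _ => τ b) (X n ω) else 0) ∂μ =
    expNeg (∫⁻ x, (1 - expNeg (∑ b, (B b).indicator (fun _ => τ b) x)) ∂ν) := by
  have hm := fun b => measurable_count h.measurable_number h.measurable_point (hB b)
  have key : ∀ ω, expNeg (∑' n : ℕ, if (n : ℕ∞) < N ω then
      ∑ b, (B b).indicator (fun _ => τ b) (X n ω) else 0) =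
      ∏ b, expNeg (count N X (B b) ω * τ b) := fun ω => by
    rw [← expNeg_sum]
    simp_rw [← tsum_ite_mem_eq_count]
    rw [← Summable.tsum_finsetSum fun _ _ => ENNReal.summable]
    congr 2; ext n; split_ifs <;> simp
  simp_rw [key]
  rw [lintegral_prod_eq_prod_lintegral_of_indepFun Finset.univ
    (fun b ω => expNeg (count N X (B b) ω * τ b))]
  · simp_rw [h.lintegral_expNeg_count (hB _) (hfin _), one_sub_expNeg_sum_indicator hd]
    rw [← expNeg_sum, lintegral_finsetSum _ fun b _ => measurable_const.indicator (hB b)]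
    congr 1
    refine Finset.sum_congr rfl fun b _ => ?_
    rw [lintegral_indicator_const (hB b)]
  · exact (h.indep_count q B hB hfin hd).comp (fun b n => expNeg ((n : ℝ≥0∞) * τ b))
      fun b => Measurable.of_discrete
  · exact fun b => (Measurable.of_discrete (f := fun n : ℕ∞ => expNeg ((n : ℝ≥0∞) * τ b))).comp
      (hm b)

lemma IsPoissonProcess.laplaceFunctional_simpleFunc (h : IsPoissonProcess N X ν μ)
    (φ : SimpleFunc E ℝ≥0∞) (hφ : ν {x | φ x ≠ 0} < ∞) :
    ∫⁻ ω, expNeg (∑' n : ℕ, if (n : ℕ∞) < N ω then φ (X n ω) else 0) ∂μ =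
      expNeg (∫⁻ x, (1 - expNeg (φ x)) ∂ν) := by
  classical
  let s := φ.range.filter (· ≠ 0)
  let e := s.equivFin.symm
  have hv : ∀ x, φ x = ∑ b, (φ ⁻¹' {(e b : ℝ≥0∞)}).indicator (fun _ => (e b : ℝ≥0∞)) x := by
    intro x
    rw [e.sum_comp (fun r : s => (φ ⁻¹' {(r : ℝ≥0∞)}).indicator (fun _ => (r : ℝ≥0∞)) x),
      Finset.sum_coe_sort s (fun r => (φ ⁻¹' {r}).indicator (fun _ => r) x)]
    by_cases hx : φ x = 0
    · rw [hx]
      refine (Finset.sum_eq_zero fun r hr => ?_).symm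
      rw [indicator_of_notMem]
      simp only [s, Finset.mem_filter] at hr
      simpa [hx] using hr.2.symm
    · rw [Finset.sum_eq_single (φ x)]
      · simp
      · intro r _ hr
        rw [indicator_of_notMem]
        simpa using hr.symm
      · intro hn
        simp [s, hx] at hn
  simp_rw [hv]
  refine h.laplaceFunctional_sum_indicator (fun b => φ.measurableSet_preimage _) (fun b => ?_)
    (fun b b' hb => ?_) _
  · refine (measure_mono fun x hx => ?_).trans_lt hφ
    have hb := (Finset.mem_filter.1 (e b).2).2
    simp only [mem_preimage, mem_singleton_iff] at hx
    simpa [hx] using hb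
  · refine Disjoint.preimage _ (disjoint_singleton.2 fun hbb => hb ?_)
    exact e.injective (Subtype.ext hbb)

/-- The Laplace functional of a Poisson process. -/
theorem IsPoissonProcess.laplaceFunctional [IsProbabilityMeasure μ] [SigmaFinite ν]
    (h : IsPoissonProcess N X ν μ) {v : E → ℝ≥0∞} (hv : Measurable v) :
    ∫⁻ ω, expNeg (∑' n : ℕ, if (n : ℕ∞) < N ω then v (X n ω) else 0) ∂μ =
      expNeg (∫⁻ x, (1 - expNeg (v x)) ∂ν) := by
  let φ : ℕ → SimpleFunc E ℝ≥0∞ := fun n => (SimpleFunc.eapprox v n).restrict (spanningSets ν n)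
  have hφ : ∀ n x, φ n x = (spanningSets ν n).indicator (SimpleFunc.eapprox v n) x := fun n x => by
    rw [SimpleFunc.restrict_apply _ (measurableSet_spanningSets ν n)]
  have hmono : ∀ x, Monotone fun n => φ n x := fun x m n hmn => by
    simp only [hφ]
    refine (indicator_le_indicator (SimpleFunc.monotone_eapprox v hmn x)).trans ?_
    exact indicator_le_indicator_of_subset (monotone_spanningSets ν hmn) (fun _ => by simp) x
  have hlim : ∀ x, Tendsto (fun n => φ n x) atTop (𝓝 (v x)) := fun x => by
    refine (SimpleFunc.tendsto_eapprox hv x).congr' ?_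
    filter_upwards [eventually_ge_atTop (spanningSetsIndex ν x)] with n hn
    rw [hφ, indicator_of_mem]
    exact monotone_spanningSets ν hn (mem_spanningSetsIndex ν x)
  have hfin : ∀ n, ν {x | φ n x ≠ 0} < ∞ := fun n =>
    (measure_mono fun x hx => by
      by_contra hx'
      exact hx (by rw [hφ, indicator_of_notMem hx'])).trans_lt (measure_spanningSets_lt_top ν n)
  have hL : Tendsto (fun k => ∫⁻ ω, expNeg (∑' n : ℕ, if (n : ℕ∞) < N ω then φ k (X n ω) else 0) ∂μ)
      atTop (𝓝 (∫⁻ ω, expNeg (∑' n : ℕ, if (n : ℕ∞) < N ω then v (X n ω) else 0) ∂μ)) := by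
    refine tendsto_lintegral_of_dominated_convergence (fun _ => 1) (fun k => ?_)
      (fun k => ae_of_all _ fun ω => expNeg_le_one _) (by simp) (ae_of_all _ fun ω => ?_)
    · exact measurable_expNeg.comp (measurable_tsum_active
        (fun n : ℕ => h.measurable_number (MeasurableSet.of_discrete (s := Ioi (n : ℕ∞)))) h.measurable_point
        (φ k).measurable)
    · refine (continuous_expNeg.tendsto _).comp ?_
      simp_rw [← lintegral_count]
      refine lintegral_tendsto_of_tendsto_of_monotone (fun k => Measurable.of_discrete.aemeasurable)
        (ae_of_all _ fun n a b hab => ?_) (ae_of_all _ fun n => ?_)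
      · dsimp only; split_ifs
        exacts [hmono _ hab, le_rfl]
      · split_ifs
        exacts [hlim _, tendsto_const_nhds]
  have hR : Tendsto (fun k => expNeg (∫⁻ x, (1 - expNeg (φ k x)) ∂ν)) atTop
      (𝓝 (expNeg (∫⁻ x, (1 - expNeg (v x)) ∂ν))) := by
    refine (continuous_expNeg.tendsto _).comp ?_
    refine lintegral_tendsto_of_tendsto_of_monotone
      (fun k => (measurable_const.sub (measurable_expNeg.comp (φ k).measurable)).aemeasurable)
      (ae_of_all _ fun x a b hab => tsub_le_tsub_left (expNeg_antitone (hmono x hab)) _)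
      (ae_of_all _ fun x => ?_)
    exact ENNReal.Tendsto.sub tendsto_const_nhds ((continuous_expNeg.tendsto _).comp (hlim x))
      (Or.inl ENNReal.one_ne_top)
  exact tendsto_nhds_unique hL (by simpa only [h.laplaceFunctional_simpleFunc _ (hfin _)] using hR)

end Poisson

end MAN

namespace MAN
open Filter Topology

/-! ### Point processes given by their Laplace functional -/

open Classical in
/-- The family of the points `Z p`, where `p` ranges over the random set of the indices with `a p`,
has the Laplace functional of a Poisson process with intensity `ν`. -/
structure HasPoissonLaplace {Ω E ι : Type*} [MeasurableSpace Ω] [MeasurableSpace E]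
    (a : ι → Ω → Prop) (Z : ι → Ω → E) (ν : Measure E) (μ : Measure Ω) : Prop where
  measurableSet_active : ∀ p, MeasurableSet {ω | a p ω}
  measurable_point : ∀ p, Measurable (Z p)
  laplace : ∀ v : E → ℝ≥0∞, Measurable v →
    ∫⁻ ω, expNeg (∑' p, if a p ω then v (Z p ω) else 0) ∂μ = expNeg (∫⁻ x, (1 - expNeg (v x)) ∂ν)

lemma expNeg_natCast_ne_zero (n : ℕ) : expNeg n ≠ 0 := by
  rw [expNeg_natCast]; simpa using Real.exp_pos _

lemma expNeg_natCast_inv_mul (n : ℕ) (u : ℝ≥0∞) : (expNeg n)⁻¹ * expNeg (n + u) = expNeg u := by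
  rw [expNeg_add, ← mul_assoc, ENNReal.inv_mul_cancel (expNeg_natCast_ne_zero n)
    (expNeg_ne_top _), one_mul]

lemma tendsto_expNeg_natCast : Tendsto (fun n : ℕ => expNeg n) atTop (𝓝 0) := by
  rw [← expNeg_top]
  exact (continuous_expNeg.tendsto _).comp ENNReal.tendsto_nat_nhds_top

lemma tendsto_expNeg_difference {r : ℝ≥0∞} (hr : r ≠ ∞) :
    Tendsto (fun n : ℕ => (expNeg n)⁻¹ * (expNeg ((1 - expNeg n) * r) - expNeg r)) atTop
      (𝓝 (r * expNeg r)) := by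
  lift r to ℝ≥0 using hr
  have hε : Tendsto (fun n : ℕ => Real.exp (-(n : ℝ))) atTop (𝓝[≠] 0) :=
    tendsto_nhdsWithin_iff.2 ⟨Real.tendsto_exp_neg_atTop_nhds_zero.comp
      tendsto_natCast_atTop_atTop, Eventually.of_forall fun n => (Real.exp_pos _).ne'⟩
  have hd : HasDerivAt (fun x : ℝ => Real.exp (-((1 - x) * r))) (r * Real.exp (-r)) 0 := by
    have h1 : HasDerivAt (fun x : ℝ => -((1 - x) * (r : ℝ))) r 0 := by
      exact (((hasDerivAt_id' (0 : ℝ)).const_sub 1).mul_const (r : ℝ)).fun_neg.congr_deriv (by simp)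
    simpa [mul_comm] using h1.exp
  have h := (ENNReal.continuous_ofReal.tendsto _).comp (hd.tendsto_slope_zero.comp hε)
  rw [ENNReal.ofReal_mul r.coe_nonneg, ENNReal.ofReal_coe_nnreal] at h
  rw [expNeg_eq_ofReal ENNReal.coe_ne_top, ENNReal.coe_toReal]
  refine h.congr fun n => ?_
  have h1 : (1 - expNeg n) * (r : ℝ≥0∞) = ENNReal.ofReal ((1 - Real.exp (-n)) * r) := by
    rw [ENNReal.ofReal_mul (by simp), ENNReal.ofReal_sub _ (Real.exp_pos _).le, expNeg_natCast,
      ENNReal.ofReal_one, ENNReal.ofReal_coe_nnreal]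
  rw [h1, expNeg_ofReal (mul_nonneg (by simp) r.coe_nonneg),
    ← ENNReal.ofReal_sub _ (Real.exp_pos _).le, expNeg_natCast,
    ← ENNReal.ofReal_inv_of_pos (Real.exp_pos _), ← ENNReal.ofReal_mul (by positivity)]
  simp

open Classical in
/-- Sum of a function over all active points except one. -/
noncomputable def sumOthers {Ω E ι : Type*} (a : ι → Ω → Prop) (Z : ι → Ω → E) (v : E → ℝ≥0∞) (p : ι)
    (ω : Ω) : ℝ≥0∞ :=
  ∑' q, if a q ω ∧ q ≠ p then v (Z q ω) else 0

open Classical in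
/-- Sum over the active points in `A` of the product of `expNeg v` over the other active points. -/
noncomputable def palmSum {Ω E ι : Type*} (a : ι → Ω → Prop) (Z : ι → Ω → E) (A : Set E)
    (v : E → ℝ≥0∞) (ω : Ω) : ℝ≥0∞ :=
  ∑' p, if a p ω ∧ Z p ω ∈ A then expNeg (sumOthers a Z v p ω) else 0

section Pointwise

variable {Ω E ι : Type*} {a : ι → Ω → Prop} {Z : ι → Ω → E}

lemma sumOthers_eq_top {v : E → ℝ≥0∞} {p q : ι} {ω : Ω} (hq : a q ω) (hqp : q ≠ p)
    (hv : v (Z q ω) = ∞) : sumOthers a Z v p ω = ∞ :=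
  ENNReal.tsum_eq_top_of_eq_top ⟨q, by simp [hq, hqp, hv]⟩

open Classical in
lemma tsum_active_eq_add {v : E → ℝ≥0∞} {p : ι} {ω : Ω} (hp : a p ω) :
    (∑' q, if a q ω then v (Z q ω) else 0) = v (Z p ω) + sumOthers a Z v p ω := by
  rw [ENNReal.tsum_eq_add_tsum_ite p, if_pos hp, sumOthers]
  congr 1
  refine tsum_congr fun q => ?_
  by_cases h : q = p <;> by_cases h' : a q ω <;> simp [h, h']

open Classical in
lemma palmSum_approx {A : Set E} {v : E → ℝ≥0∞} (hv : ∀ x ∈ A, v x = ∞) (ω : Ω) :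
    (∀ n : ℕ, (expNeg n)⁻¹ *
      (expNeg (∑' p, if a p ω then A.piecewise (fun _ => (n : ℝ≥0∞)) v (Z p ω) else 0) -
        expNeg (∑' p, if a p ω then v (Z p ω) else 0)) ≤ 1) ∧
    Tendsto (fun n : ℕ => (expNeg n)⁻¹ *
      (expNeg (∑' p, if a p ω then A.piecewise (fun _ => (n : ℝ≥0∞)) v (Z p ω) else 0) -
        expNeg (∑' p, if a p ω then v (Z p ω) else 0))) atTop (𝓝 (palmSum a Z A v ω)) := by
  by_cases h0 : ∃ p, a p ω ∧ Z p ω ∈ A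
  · obtain ⟨p, hp, hpA⟩ := h0
    have htop : (∑' p, if a p ω then v (Z p ω) else 0) = ∞ :=
      ENNReal.tsum_eq_top_of_eq_top ⟨p, by simp [hp, hv _ hpA]⟩
    rw [htop, expNeg_top]
    have hval : ∀ n : ℕ, (expNeg n)⁻¹ *
        (expNeg (∑' p, if a p ω then A.piecewise (fun _ => (n : ℝ≥0∞)) v (Z p ω) else 0) - 0) =
        expNeg (sumOthers a Z (A.piecewise (fun _ => (n : ℝ≥0∞)) v) p ω) := fun n => by
      rw [tsum_active_eq_add hp, tsub_zero, piecewise_eq_of_mem _ _ _ hpA, expNeg_natCast_inv_mul]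
    simp_rw [hval]
    refine ⟨fun n => expNeg_le_one _, ?_⟩
    by_cases h1 : ∃ q, q ≠ p ∧ a q ω ∧ Z q ω ∈ A
    · obtain ⟨q, hqp, hq, hqA⟩ := h1
      have hpalm : palmSum a Z A v ω = 0 := by
        refine ENNReal.tsum_eq_zero.2 fun p' => ?_
        split_ifs with hp'
        · by_cases hpp : p' = p
          · rw [hpp, sumOthers_eq_top hq hqp (hv _ hqA), expNeg_top]
          · rw [sumOthers_eq_top hp (Ne.symm hpp) (hv _ hpA), expNeg_top]
        · rfl
      rw [hpalm]
      refine tendsto_of_tendsto_of_tendsto_of_le_of_le tendsto_const_nhds tendsto_expNeg_natCast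
        (fun _ => zero_le) fun n => expNeg_antitone ?_
      refine le_trans ?_ (ENNReal.le_tsum q)
      simp [hq, hqp, hqA]
    · push Not at h1
      have hpalm : palmSum a Z A v ω = expNeg (sumOthers a Z v p ω) := by
        rw [palmSum, tsum_eq_single p fun q hqp => if_neg fun h => h1 q hqp h.1 h.2,
          if_pos ⟨hp, hpA⟩]
      rw [hpalm]
      refine tendsto_const_nhds.congr fun n => ?_
      congr 1
      refine tsum_congr fun q => ?_
      split_ifs with hq
      · rw [piecewise_eq_of_notMem _ _ _ (h1 q hq.2 hq.1)]
      · rfl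
  · push Not at h0
    have hpalm : palmSum a Z A v ω = 0 :=
      ENNReal.tsum_eq_zero.2 fun p => if_neg fun h => h0 p h.1 h.2
    have heq : ∀ n : ℕ, (∑' p, if a p ω then A.piecewise (fun _ => (n : ℝ≥0∞)) v (Z p ω) else 0) =
        ∑' p, if a p ω then v (Z p ω) else 0 := fun n => by
      refine tsum_congr fun q => ?_
      split_ifs with hq
      · rw [piecewise_eq_of_notMem _ _ _ (h0 q hq)]
      · rfl
    simp [heq, hpalm]

end Pointwise

section Palm

variable {Ω E ι : Type*} [Countable ι] [MeasurableSpace Ω] [MeasurableSpace E]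
  {a : ι → Ω → Prop} {Z : ι → Ω → E} {ν : Measure E} {μ : Measure Ω}

lemma HasPoissonLaplace.measurable_palmSum (h : HasPoissonLaplace a Z ν μ) {A : Set E}
    (hA : MeasurableSet A) {v : E → ℝ≥0∞} (hv : Measurable v) : Measurable (palmSum a Z A v) := by
  refine Measurable.tsum fun p => Measurable.ite
    ((h.measurableSet_active p).inter (h.measurable_point p hA)) (measurable_expNeg.comp ?_)
    measurable_const
  exact Measurable.tsum fun q => Measurable.ite
    ((h.measurableSet_active q).inter (MeasurableSet.const _)) (hv.comp (h.measurable_point q))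
    measurable_const

open Classical in
lemma HasPoissonLaplace.lintegral_palmSum [IsProbabilityMeasure μ] (h : HasPoissonLaplace a Z ν μ)
    {A : Set E} (hA : MeasurableSet A) (hfin : ν A ≠ ∞) {v : E → ℝ≥0∞} (hv : Measurable v)
    (hvA : ∀ x ∈ A, v x = ∞) :
    ∫⁻ ω, palmSum a Z A v ω ∂μ = ν A * expNeg (∫⁻ x, (1 - expNeg (v x)) ∂ν) := by
  have hvn : ∀ n : ℕ, Measurable (A.piecewise (fun _ => (n : ℝ≥0∞)) v) := fun n =>
    Measurable.piecewise hA measurable_const hv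
  have hm : ∀ w : E → ℝ≥0∞, Measurable w →
      Measurable fun ω => expNeg (∑' p, if a p ω then w (Z p ω) else 0) := fun w hw =>
    measurable_expNeg.comp (measurable_tsum_active h.measurableSet_active h.measurable_point hw)
  have hms : ∀ n : ℕ, Measurable fun ω =>
      expNeg (∑' p, if a p ω then A.piecewise (fun _ => (n : ℝ≥0∞)) v (Z p ω) else 0) -
        expNeg (∑' p, if a p ω then v (Z p ω) else 0) := fun n => (hm _ (hvn n)).sub (hm v hv)
  set C := ∫⁻ x in Aᶜ, (1 - expNeg (v x)) ∂ν
  have hC : ∫⁻ x, (1 - expNeg (v x)) ∂ν = C + ν A := by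
    rw [← lintegral_add_compl _ hA, add_comm]
    congr 1
    rw [setLIntegral_congr_fun hA (g := fun _ => 1) fun x hx => by simp [hvA x hx]]
    simp
  have hCn : ∀ n : ℕ, ∫⁻ x, (1 - expNeg (A.piecewise (fun _ => (n : ℝ≥0∞)) v x)) ∂ν =
      C + (1 - expNeg n) * ν A := fun n => by
    rw [← lintegral_add_compl _ hA, add_comm]
    congr 1
    · exact setLIntegral_congr_fun hA.compl fun x hx => by
        rw [piecewise_eq_of_notMem _ _ _ hx]
    · rw [setLIntegral_congr_fun hA (g := fun _ => 1 - expNeg n) fun x hx => by simp [hx]]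
      simp
  have hlim := tendsto_lintegral_of_dominated_convergence (μ := μ) (fun _ => 1)
    (fun n : ℕ => (hms n).const_mul (expNeg n)⁻¹)
    (fun n => ae_of_all _ fun ω => (palmSum_approx hvA ω).1 n) (by simp)
    (ae_of_all _ fun ω => (palmSum_approx hvA ω).2)
  refine tendsto_nhds_unique hlim ?_
  have hint : ∀ n : ℕ, ∫⁻ ω, (expNeg n)⁻¹ *
      (expNeg (∑' p, if a p ω then A.piecewise (fun _ => (n : ℝ≥0∞)) v (Z p ω) else 0) -
        expNeg (∑' p, if a p ω then v (Z p ω) else 0)) ∂μ =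
      expNeg C * ((expNeg n)⁻¹ * (expNeg ((1 - expNeg n) * ν A) - expNeg (ν A))) := fun n => by
    rw [lintegral_const_mul _ (hms n), lintegral_sub (hm v hv) (by
      rw [h.laplace v hv]; exact expNeg_ne_top _) (ae_of_all _ fun ω => ?_),
      h.laplace v hv, h.laplace _ (hvn n), hC, hCn, expNeg_add, expNeg_add,
      ← ENNReal.mul_sub (fun _ _ => expNeg_ne_top _)]
    · ring
    · refine expNeg_antitone (ENNReal.tsum_le_tsum fun p => ?_)
      split_ifs
      · by_cases hp : Z p ω ∈ A
        · simp [hvA _ hp]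
        · simp [hp]
      · exact le_rfl
  simp_rw [hint]
  rw [hC, expNeg_add, mul_left_comm]
  exact ENNReal.Tendsto.const_mul (tendsto_expNeg_difference hfin) (Or.inr (expNeg_ne_top _))

lemma HasPoissonLaplace.ae_finite [IsProbabilityMeasure μ] (h : HasPoissonLaplace a Z ν μ)
    {A : Set E} (hA : MeasurableSet A) (hfin : ν A ≠ ∞) :
    ∀ᵐ ω ∂μ, {p | a p ω ∧ Z p ω ∈ A}.Finite := by
  classical
  have hm : ∀ τ : ℝ≥0∞, Measurable (A.indicator fun _ => τ) := fun τ =>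
    measurable_const.indicator hA
  set S : Ω → ℝ≥0∞ := fun ω => ∑' p, if a p ω then A.indicator (fun _ => 1) (Z p ω) else 0
  have hS : Measurable S :=
    measurable_tsum_active h.measurableSet_active h.measurable_point (hm 1)
  have hSm : MeasurableSet {ω | S ω ≠ ∞} := hS (measurableSet_singleton _).compl
  have hle : ∀ ε : ℝ≥0∞, ε ≠ 0 → expNeg ((1 - expNeg ε) * ν A) ≤ μ {ω | S ω ≠ ∞} := fun ε hε => by
    have h1 := h.laplace _ (hm ε)
    have h2 : ∫⁻ x, (1 - expNeg (A.indicator (fun _ => ε) x)) ∂ν = (1 - expNeg ε) * ν A := by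
      rw [← lintegral_indicator_const hA]
      refine lintegral_congr fun x => ?_
      by_cases hx : x ∈ A <;> simp [hx]
    rw [← h2, ← h1, ← lintegral_indicator_one hSm]
    refine lintegral_mono fun ω => ?_
    have h3 : (∑' p, if a p ω then A.indicator (fun _ => ε) (Z p ω) else 0) = ε * S ω := by
      rw [← ENNReal.tsum_mul_left]
      refine tsum_congr fun p => ?_
      by_cases hp : Z p ω ∈ A <;> simp [hp]
    simp only [h3]
    by_cases hω : S ω = ∞
    · simp [hω, hε]
    · simpa [indicator_of_mem (show ω ∈ {ω | S ω ≠ ∞} from hω)] using expNeg_le_one _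
  have hone : μ {ω | S ω ≠ ∞} = 1 := by
    refine le_antisymm prob_le_one ?_
    have hlim : Tendsto (fun n : ℕ => expNeg ((1 - expNeg ((n : ℝ≥0∞)⁻¹)) * ν A)) atTop (𝓝 1) := by
      have h0 : Tendsto (fun n : ℕ => (1 - expNeg ((n : ℝ≥0∞)⁻¹)) * ν A) atTop (𝓝 0) := by
        have h4 := ENNReal.Tendsto.sub (tendsto_const_nhds (x := (1 : ℝ≥0∞)))
          ((continuous_expNeg.tendsto 0).comp ENNReal.tendsto_inv_nat_nhds_zero)
          (Or.inl ENNReal.one_ne_top)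
        have h5 := ENNReal.Tendsto.mul_const h4 (Or.inr hfin)
        simpa using h5
      have h6 := (continuous_expNeg.tendsto 0).comp h0
      rwa [expNeg_zero] at h6
    exact le_of_tendsto hlim (Eventually.of_forall fun n => hle _ (by simp))
  have hae : ∀ᵐ ω ∂μ, S ω ≠ ∞ := by
    rw [← prob_compl_eq_zero_iff hSm] at hone
    exact hone
  filter_upwards [hae] with ω hω
  by_contra hinf
  refine hω ?_
  have : S ω = ∑' p, {p | a p ω ∧ Z p ω ∈ A}.indicator (fun _ => (1 : ℝ≥0∞)) p := by
    refine tsum_congr fun p => ?_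
    by_cases hp : a p ω <;> by_cases hp' : Z p ω ∈ A <;> simp [hp, hp']
  rw [this, ← tsum_subtype, ENNReal.tsum_set_one, encard_eq_top hinf, ENat.toENNReal_top]

end Palm

end MAN

namespace MAN
open Filter Topology

/-! ### The point of maximal score -/

/-- Cost `c` for the points of score less than `t`, infinite cost for the others. -/
noncomputable def levelCost {E : Type*} (σ : E → ℝ) (c : E → ℝ≥0∞) (t : ℝ) (x : E) : ℝ≥0∞ :=
  if σ x < t then c x else ∞

open Classical in
/-- Sum over the points in `A` which, up to a rounding `L` of the levels, have a score larger than
all other points, of the product of `expNeg c` over the other points and of a function `Ψ` of the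
score. -/
noncomputable def maxSum {Ω E ι : Type*} (a : ι → Ω → Prop) (Z : ι → Ω → E) (A : Set E) (σ : E → ℝ)
    (L : ℝ → ℝ) (c : E → ℝ≥0∞) (Ψ : ℝ → ℝ≥0∞) (ω : Ω) : ℝ≥0∞ :=
  ∑' p, if a p ω ∧ Z p ω ∈ A ∧ 0 < L (σ (Z p ω)) then
    expNeg (sumOthers a Z (levelCost σ c (L (σ (Z p ω)))) p ω) * Ψ (L (σ (Z p ω))) else 0

/-- Rounding down to a multiple of `1 / (n + 1)`. -/
noncomputable def gridFloor (n : ℕ) (t : ℝ) : ℝ := ⌊t * (n + 1)⌋₊ / (n + 1)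

lemma gridFloor_le (n : ℕ) {t : ℝ} (h : 0 < gridFloor n t) : gridFloor n t ≤ t := by
  have hn : (0 : ℝ) < n + 1 := by positivity
  rw [gridFloor, div_le_iff₀ hn]
  refine Nat.floor_le ?_
  by_contra! hneg
  simp [gridFloor, Nat.floor_of_nonpos hneg.le] at h

lemma tendsto_gridFloor {t : ℝ} (ht : 0 ≤ t) :
    Tendsto (fun n : ℕ => gridFloor n t) atTop (𝓝 t) := by
  have h := (tendsto_nat_floor_mul_div_atTop ht).comp
    (tendsto_natCast_atTop_atTop.comp (tendsto_add_atTop_nat 1))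
  refine h.congr fun n => ?_
  simp [gridFloor]

section Deterministic

variable {Ω E ι : Type*} {a : ι → Ω → Prop} {Z : ι → Ω → E} {A : Set E} {σ : E → ℝ}
  {c : E → ℝ≥0∞} {Ψ : ℝ → ℝ≥0∞} {ω : Ω}

lemma expNeg_sumOthers_levelCost_eq_zero {p q : ι} {t : ℝ} (hq : a q ω) (hqp : q ≠ p)
    (h : t ≤ σ (Z q ω)) : expNeg (sumOthers a Z (levelCost σ c t) p ω) = 0 := by
  rw [sumOthers_eq_top hq hqp (if_neg h.not_gt), expNeg_top]

/-- The index `p` is that of the unique point of maximal score, it lies in `A`, and its score is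
positive. -/
def IsTop (a : ι → Ω → Prop) (Z : ι → Ω → E) (A : Set E) (σ : E → ℝ) (p : ι) (ω : Ω) : Prop :=
  a p ω ∧ Z p ω ∈ A ∧ 0 < σ (Z p ω) ∧ ∀ q, a q ω → q ≠ p → σ (Z q ω) < σ (Z p ω)

open Classical in
lemma maxSum_eq_of_isTop {L : ℝ → ℝ} (hL : ∀ t, 0 < L t → L t ≤ t) {p : ι}
    (hp : IsTop a Z A σ p ω) : maxSum a Z A σ L c Ψ ω = if 0 < L (σ (Z p ω)) then
      expNeg (sumOthers a Z (levelCost σ c (L (σ (Z p ω)))) p ω) * Ψ (L (σ (Z p ω))) else 0 := by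
  rw [maxSum, tsum_eq_single p]
  · simp [hp.1, hp.2.1]
  · intro q hqp
    split_ifs with h
    · rw [expNeg_sumOthers_levelCost_eq_zero hp.1 hqp.symm
        ((hL _ h.2.2).trans (hp.2.2.2 q h.1 hqp).le), zero_mul]
    · rfl

lemma maxSum_eq_zero {L : ℝ → ℝ} (hL : ∀ t, 0 < L t → L t ≤ t)
    (hp : ¬ ∃ p, IsTop a Z A σ p ω) : maxSum a Z A σ L c Ψ ω = 0 := by
  refine ENNReal.tsum_eq_zero.2 fun p => ?_
  split_ifs with h
  · have : ¬ ∀ q, a q ω → q ≠ p → σ (Z q ω) < σ (Z p ω) := fun h' =>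
      hp ⟨p, h.1, h.2.1, h.2.2.trans_le (hL _ h.2.2), h'⟩
    push Not at this
    obtain ⟨q, hq, hqp, hle⟩ := this
    rw [expNeg_sumOthers_levelCost_eq_zero hq hqp ((hL _ h.2.2).trans hle), zero_mul]
  · rfl

lemma maxSum_le_one {L : ℝ → ℝ} (hL : ∀ t, 0 < L t → L t ≤ t) (hΨ : ∀ t, Ψ t ≤ 1) :
    maxSum a Z A σ L c Ψ ω ≤ 1 := by
  by_cases h : ∃ p, IsTop a Z A σ p ω
  · obtain ⟨p, hp⟩ := h
    rw [maxSum_eq_of_isTop hL hp]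
    split_ifs
    · exact mul_le_one' (expNeg_le_one _) (hΨ _)
    · exact zero_le_one
  · rw [maxSum_eq_zero hL h]; exact zero_le_one

lemma tendsto_maxSum {L : ℕ → ℝ → ℝ} (hL : ∀ n t, 0 < L n t → L n t ≤ t)
    (hlim : ∀ t, 0 < t → Tendsto (fun n => L n t) atTop (𝓝 t))
    (hΨ : ∀ (t : ℝ) (u : ℕ → ℝ), 0 < t → (∀ᶠ n in atTop, u n ≤ t) → Tendsto u atTop (𝓝 t) →
      Tendsto (fun n => Ψ (u n)) atTop (𝓝 (Ψ t)))
    (hfin : ∀ t : ℝ, 0 < t → {p | a p ω ∧ t ≤ σ (Z p ω)}.Finite) :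
    Tendsto (fun n => maxSum a Z A σ (L n) c Ψ ω) atTop (𝓝 (maxSum a Z A σ id c Ψ ω)) := by
  by_cases h : ∃ p, IsTop a Z A σ p ω
  · obtain ⟨p, hp⟩ := h
    have hσ := hp.2.2.1
    have hpos : ∀ᶠ n in atTop, 0 < L n (σ (Z p ω)) := (hlim _ hσ).eventually_const_lt hσ
    have hhalf : ∀ᶠ n in atTop, σ (Z p ω) / 2 < L n (σ (Z p ω)) :=
      (hlim _ hσ).eventually_const_lt (half_lt_self hσ)
    have hothers : ∀ᶠ n in atTop, ∀ q ∈ {q | a q ω ∧ σ (Z p ω) / 2 ≤ σ (Z q ω)}, q ≠ p →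
        σ (Z q ω) < L n (σ (Z p ω)) := by
      rw [eventually_all_finite (hfin _ (half_pos hσ))]
      intro q hq
      by_cases hqp : q = p
      · simp [hqp]
      · filter_upwards [(hlim _ hσ).eventually_const_lt (hp.2.2.2 q hq.1 hqp)] with n hn _
        exact hn
    simp_rw [maxSum_eq_of_isTop (hL _) hp]
    rw [maxSum_eq_of_isTop (L := id) (fun _ _ => le_rfl) hp, id, if_pos hσ]
    have hval : ∀ᶠ n in atTop, (expNeg (sumOthers a Z (levelCost σ c (σ (Z p ω))) p ω) *
        Ψ (L n (σ (Z p ω)))) = if 0 < L n (σ (Z p ω)) then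
        expNeg (sumOthers a Z (levelCost σ c (L n (σ (Z p ω)))) p ω) * Ψ (L n (σ (Z p ω)))
        else 0 := by
      filter_upwards [hpos, hhalf, hothers] with n h1 h2 h3
      rw [if_pos h1]
      congr 2
      refine tsum_congr fun q => ?_
      split_ifs with hq
      · rw [levelCost, levelCost, if_pos (hp.2.2.2 q hq.1 hq.2), if_pos]
        by_cases h4 : σ (Z p ω) / 2 ≤ σ (Z q ω)
        · exact h3 q ⟨hq.1, h4⟩ hq.2
        · exact (not_le.1 h4).trans h2
      · rfl
    refine Tendsto.congr' hval ?_
    refine ENNReal.Tendsto.const_mul (hΨ _ _ hσ ?_ (hlim _ hσ)) (Or.inr (expNeg_ne_top _))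
    filter_upwards [hpos] with n h1 using hL n _ h1
  · simp_rw [maxSum_eq_zero (hL _) h]
    rw [maxSum_eq_zero (L := id) (fun _ _ => le_rfl) h]
    exact tendsto_const_nhds

open Classical in
lemma maxSum_gridFloor (n : ℕ) : maxSum a Z A σ (gridFloor n) c Ψ ω =
    ∑' l : ℕ, Ψ ((l + 1 : ℕ) / (n + 1)) *
      palmSum a Z (A ∩ {x | ⌊σ x * (n + 1)⌋₊ = l + 1})
        (levelCost σ c ((l + 1 : ℕ) / (n + 1))) ω := by
  simp_rw [palmSum, ← ENNReal.tsum_mul_left]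
  rw [ENNReal.tsum_comm, maxSum]
  refine tsum_congr fun p => ?_
  have hn : (0 : ℝ) < n + 1 := by positivity
  rcases hm : ⌊σ (Z p ω) * (n + 1)⌋₊ with _ | m
  · rw [if_neg (by simp [gridFloor, hm])]
    refine (ENNReal.tsum_eq_zero.2 fun l => ?_).symm
    rw [if_neg (by simp [hm]), mul_zero]
  · have hg : gridFloor n (σ (Z p ω)) = (m + 1 : ℕ) / (n + 1) := by rw [gridFloor, hm]
    rw [tsum_eq_single m]
    · have : 0 < gridFloor n (σ (Z p ω)) := by rw [hg]; positivity
      by_cases h : a p ω ∧ Z p ω ∈ A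
      · rw [if_pos ⟨h.1, h.2, this⟩, if_pos ⟨h.1, h.2, hm⟩, hg, mul_comm]
      · rw [if_neg fun h' => h ⟨h'.1, h'.2.1⟩, if_neg fun h' => h ⟨h'.1, h'.2.1⟩, mul_zero]
    · intro l hl
      rw [if_neg, mul_zero]
      rintro ⟨_, _, h⟩
      simp only [mem_ofPred_eq, hm] at h
      omega

end Deterministic

section Probabilistic

variable {Ω E ι : Type*} [Countable ι] [MeasurableSpace Ω] [MeasurableSpace E]
  {a : ι → Ω → Prop} {Z : ι → Ω → E} {ν : Measure E} {μ : Measure Ω} {A : Set E} {σ : E → ℝ}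
  {c : E → ℝ≥0∞}

lemma measurable_levelCost (hσ : Measurable σ) (hc : Measurable c) :
    Measurable fun z : ℝ × E => levelCost σ c z.1 z.2 :=
  Measurable.ite (measurableSet_lt (hσ.comp measurable_snd) measurable_fst)
    (hc.comp measurable_snd) measurable_const

lemma HasPoissonLaplace.measurable_maxSum (h : HasPoissonLaplace a Z ν μ) (hA : MeasurableSet A)
    (hσ : Measurable σ) (hc : Measurable c) {L : ℝ → ℝ} (hL : Measurable L) {Ψ : ℝ → ℝ≥0∞}
    (hΨ : Measurable Ψ) : Measurable (maxSum a Z A σ L c Ψ) := by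
  have hLσ : ∀ p, Measurable fun ω => L (σ (Z p ω)) := fun p =>
    hL.comp (hσ.comp (h.measurable_point p))
  refine Measurable.tsum fun p => Measurable.ite ((h.measurableSet_active p).inter
    ((h.measurable_point p hA).inter (hLσ p measurableSet_Ioi)))
    ((measurable_expNeg.comp ?_).mul (hΨ.comp (hLσ p))) measurable_const
  exact Measurable.tsum fun q => Measurable.ite
    ((h.measurableSet_active q).inter (MeasurableSet.const _))
    ((measurable_levelCost hσ hc).comp ((hLσ p).prodMk (h.measurable_point q))) measurable_const

/-- Laplace functional of the points of score less than `t`. -/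
noncomputable def belowLaplace (ν : Measure E) (σ : E → ℝ) (c : E → ℝ≥0∞) (t : ℝ) : ℝ≥0∞ :=
  expNeg (∫⁻ x in {x | σ x < t}, (1 - expNeg (c x)) ∂ν)

lemma monotone_lintegral_below (f : E → ℝ≥0∞) :
    Monotone fun t : ℝ => ∫⁻ x in {x | σ x < t}, f x ∂ν := fun _ _ hst =>
  lintegral_mono_set fun _ hx => lt_of_lt_of_le hx hst

lemma measurable_belowLaplace : Measurable (belowLaplace ν σ c) :=
  measurable_expNeg.comp (monotone_lintegral_below _).measurable

lemma tendsto_belowLaplace (hσ : Measurable σ) (hc : Measurable c) {t : ℝ} {u : ℕ → ℝ}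
    (hut : ∀ᶠ n in atTop, u n ≤ t) (hu : Tendsto u atTop (𝓝 t)) :
    Tendsto (fun n => belowLaplace ν σ c (u n)) atTop (𝓝 (belowLaplace ν σ c t)) := by
  refine (continuous_expNeg.tendsto _).comp ?_
  have hms : ∀ t, MeasurableSet {x | σ x < t} := fun t => hσ measurableSet_Iio
  have hm : Measurable fun x => 1 - expNeg (c x) := measurable_const.sub (measurable_expNeg.comp hc)
  refine tendsto_of_le_liminf_of_limsup_le ?_ (limsup_le_of_le (by isBoundedDefault) ?_)
  · simp_rw [← lintegral_indicator (hms _)]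
    refine le_trans (lintegral_mono fun x => ?_)
      (lintegral_liminf_le fun n => hm.indicator (hms (u n)))
    refine le_liminf_of_le (by isBoundedDefault) ?_
    by_cases hx : σ x < t
    · filter_upwards [hu.eventually_const_lt hx] with n hn
      rw [indicator_of_mem (show x ∈ {x | σ x < t} from hx),
        indicator_of_mem (show x ∈ {x | σ x < u n} from hn)]
    · rw [indicator_of_notMem (show x ∉ {x | σ x < t} from hx)]
      exact Eventually.of_forall fun n => zero_le
  · filter_upwards [hut] with n hn
    exact monotone_lintegral_below _ hn

lemma expNeg_lintegral_levelCost (hσ : Measurable σ) (t : ℝ) :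
    expNeg (∫⁻ x, (1 - expNeg (levelCost σ c t x)) ∂ν) =
      expNeg (ν {x | t ≤ σ x}) * belowLaplace ν σ c t := by
  have hms : MeasurableSet {x | σ x < t} := hσ measurableSet_Iio
  have hc' : {x | σ x < t}ᶜ = {x | t ≤ σ x} := by ext; simp
  rw [belowLaplace, ← expNeg_add, ← lintegral_add_compl _ hms, add_comm]
  congr 2
  · rw [setLIntegral_congr_fun hms.compl (g := fun _ => 1) fun x hx => ?_, setLIntegral_const,
      one_mul, hc']
    simp [levelCost, show ¬ σ x < t from hx]
  · refine setLIntegral_congr_fun hms fun x hx => ?_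
    simp [levelCost, show σ x < t from hx]

lemma HasPoissonLaplace.lintegral_maxSum_gridFloor [IsProbabilityMeasure μ]
    (h : HasPoissonLaplace a Z ν μ) (hA : MeasurableSet A) (hσ : Measurable σ)
    (hfin : ∀ t : ℝ, 0 < t → ν {x | t ≤ σ x} ≠ ∞) (hc : Measurable c) (n : ℕ) :
    ∫⁻ ω, maxSum a Z A σ (gridFloor n) c (fun _ => 1) ω ∂μ =
      ∫⁻ ω, maxSum a Z A σ (gridFloor n) (fun _ => 0) (belowLaplace ν σ c) ω ∂μ := by
  have hn : (0 : ℝ) < n + 1 := by positivity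
  have hAl : ∀ l : ℕ, MeasurableSet (A ∩ {x | ⌊σ x * (n + 1)⌋₊ = l + 1}) := fun l =>
    hA.inter ((Nat.measurable_floor.comp (hσ.mul_const _)) (measurableSet_singleton (l + 1)))
  have hlev : ∀ l : ℕ, ∀ x ∈ A ∩ {x | ⌊σ x * (n + 1)⌋₊ = l + 1},
      ((l + 1 : ℕ) : ℝ) / (n + 1) ≤ σ x := fun l x hx => by
    have hg : gridFloor n (σ x) = (l + 1 : ℕ) / (n + 1) := by
      rw [gridFloor, show ⌊σ x * (n + 1)⌋₊ = l + 1 from hx.2]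
    rw [← hg]
    exact gridFloor_le n (by rw [hg]; positivity)
  have hkey : ∀ (l : ℕ) (c' : E → ℝ≥0∞), Measurable c' →
      ∫⁻ ω, palmSum a Z (A ∩ {x | ⌊σ x * (n + 1)⌋₊ = l + 1})
        (levelCost σ c' ((l + 1 : ℕ) / (n + 1))) ω ∂μ =
      ν (A ∩ {x | ⌊σ x * (n + 1)⌋₊ = l + 1}) *
        (expNeg (ν {x | ((l + 1 : ℕ) : ℝ) / (n + 1) ≤ σ x}) *
          belowLaplace ν σ c' ((l + 1 : ℕ) / (n + 1))) := fun l c' hc' => by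
    rw [h.lintegral_palmSum (hAl l), expNeg_lintegral_levelCost hσ]
    · exact ne_top_of_le_ne_top (hfin (((l + 1 : ℕ) : ℝ) / (n + 1)) (by positivity))
        (measure_mono (hlev l))
    · exact (measurable_levelCost hσ hc').comp measurable_prodMk_left
    · exact fun x hx => if_neg (hlev l x hx).not_gt
  have hmeas : ∀ (l : ℕ) (c' : E → ℝ≥0∞), Measurable c' →
      Measurable fun ω => palmSum a Z (A ∩ {x | ⌊σ x * (n + 1)⌋₊ = l + 1})
        (levelCost σ c' ((l + 1 : ℕ) / (n + 1))) ω := fun l c' hc' =>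
    h.measurable_palmSum (hAl l) ((measurable_levelCost hσ hc').comp measurable_prodMk_left)
  simp_rw [maxSum_gridFloor]
  rw [lintegral_tsum fun l => ((hmeas l c hc).const_mul _).aemeasurable,
    lintegral_tsum fun l => ((hmeas l _ measurable_const).const_mul _).aemeasurable]
  refine tsum_congr fun l => ?_
  rw [lintegral_const_mul _ (hmeas l c hc), lintegral_const_mul _ (hmeas l _ measurable_const),
    hkey l c hc, hkey l _ measurable_const]
  simp only [belowLaplace, expNeg_zero, tsub_self, lintegral_zero]
  ring

/-- In a Poisson process, given the score of the point of maximal score, the other points form a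
Poisson process of points of smaller score. -/
theorem HasPoissonLaplace.lintegral_maxSum [IsProbabilityMeasure μ]
    (h : HasPoissonLaplace a Z ν μ) (hA : MeasurableSet A) (hσ : Measurable σ)
    (hfin : ∀ t : ℝ, 0 < t → ν {x | t ≤ σ x} ≠ ∞) (hc : Measurable c) :
    ∫⁻ ω, maxSum a Z A σ id c (fun _ => 1) ω ∂μ =
      ∫⁻ ω, maxSum a Z A σ id (fun _ => 0) (belowLaplace ν σ c) ω ∂μ := by
  have hgm : ∀ n, Measurable (gridFloor n) := fun n =>
    ((measurable_from_nat (f := fun m : ℕ => (m : ℝ))).comp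
      (Nat.measurable_floor.comp (measurable_id.mul_const _))).div_const _
  have hae : ∀ᵐ ω ∂μ, ∀ t : ℝ, 0 < t → {p | a p ω ∧ t ≤ σ (Z p ω)}.Finite := by
    have : ∀ᵐ ω ∂μ, ∀ m : ℕ, {p | a p ω ∧ Z p ω ∈ {x | 1 / ((m : ℝ) + 1) ≤ σ x}}.Finite :=
      ae_all_iff.2 fun m => h.ae_finite (hσ measurableSet_Ici) (hfin _ (by positivity))
    filter_upwards [this] with ω hω t ht
    obtain ⟨m, hm⟩ := exists_nat_one_div_lt ht
    exact (hω m).subset fun p hp => ⟨hp.1, hm.le.trans hp.2⟩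
  have hlim : ∀ (c' : E → ℝ≥0∞) (Ψ : ℝ → ℝ≥0∞), Measurable c' → Measurable Ψ → (∀ t, Ψ t ≤ 1) →
      (∀ (t : ℝ) (u : ℕ → ℝ), 0 < t → (∀ᶠ n in atTop, u n ≤ t) → Tendsto u atTop (𝓝 t) →
        Tendsto (fun n => Ψ (u n)) atTop (𝓝 (Ψ t))) →
      Tendsto (fun n => ∫⁻ ω, maxSum a Z A σ (gridFloor n) c' Ψ ω ∂μ) atTop
        (𝓝 (∫⁻ ω, maxSum a Z A σ id c' Ψ ω ∂μ)) := fun c' Ψ hc' hΨ hΨ1 hΨc =>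
    tendsto_lintegral_of_dominated_convergence (fun _ => 1)
      (fun n => h.measurable_maxSum hA hσ hc' (hgm n) hΨ)
      (fun n => ae_of_all _ fun ω => maxSum_le_one (fun t => gridFloor_le n) hΨ1) (by simp) (by
        filter_upwards [hae] with ω hω
        exact tendsto_maxSum (fun n t => gridFloor_le n) (fun t ht => tendsto_gridFloor ht.le)
          hΨc hω)
  refine tendsto_nhds_unique (hlim c _ hc measurable_const (fun _ => le_rfl)
    fun t u _ _ _ => tendsto_const_nhds) ?_
  simp_rw [h.lintegral_maxSum_gridFloor hA hσ hfin hc]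
  exact hlim _ _ measurable_const measurable_belowLaplace (fun _ => expNeg_le_one _)
    fun t u _ hut hu => tendsto_belowLaplace hσ hc hut hu

end Probabilistic

end MAN

namespace MAN
open Filter Topology

/-! ### Independent marks -/

section Marks

variable {Ω β γ ι : Type*} [MeasurableSpace Ω] [MeasurableSpace β] [MeasurableSpace γ]
  {μ : Measure Ω} [IsProbabilityMeasure μ] {Y : Ω → β} {M : ι → Ω → γ} {ϖ : Measure γ}

lemma lintegral_prod_marks (hY : Measurable Y) (hM : ∀ p, Measurable (M p))
    (hind : ∀ (s : Finset ι) (p : ι), p ∉ s → IndepFun (fun ω => (Y ω, fun q : s => M q ω)) (M p) μ)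
    (hlaw : ∀ p, μ.map (M p) = ϖ) [SFinite ϖ] {f : ι → β × γ → ℝ≥0∞} (hf : ∀ p, Measurable (f p))
    (s : Finset ι) : ∀ {g : β → ℝ≥0∞}, Measurable g →
    ∫⁻ ω, g (Y ω) * ∏ p ∈ s, f p (Y ω, M p ω) ∂μ =
      ∫⁻ ω, g (Y ω) * ∏ p ∈ s, ∫⁻ y, f p (Y ω, y) ∂ϖ ∂μ := by
  classical
  induction s using Finset.induction_on with
  | empty => simp
  | insert p s hp ih =>
    intro g hg
    let F : (β × (s → γ)) × γ → ℝ≥0∞ := fun z =>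
      (g z.1.1 * ∏ q : s, f q (z.1.1, z.1.2 q)) * f p (z.1.1, z.2)
    have hF : Measurable F := by
      refine Measurable.mul (Measurable.mul (by fun_prop) (Finset.measurable_prod _ fun q _ => ?_))
        (by fun_prop)
      fun_prop
    have h1 := lintegral_of_indepFun (hY.prodMk (measurable_pi_lambda _ fun q : s => hM q)) (hM p)
      (hind s p hp) hF
    have h2 : ∀ ω, ∏ q : s, f q (Y ω, M q ω) = ∏ q ∈ s, f q (Y ω, M q ω) := fun ω =>
      Finset.prod_coe_sort s fun q => f q (Y ω, M q ω)
    simp only [F, h2, hlaw] at h1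
    calc ∫⁻ ω, g (Y ω) * ∏ q ∈ insert p s, f q (Y ω, M q ω) ∂μ
        = ∫⁻ ω, (g (Y ω) * ∏ q ∈ s, f q (Y ω, M q ω)) * f p (Y ω, M p ω) ∂μ := by
          simp_rw [Finset.prod_insert hp]
          refine lintegral_congr fun ω => by ring
      _ = ∫⁻ ω, (g (Y ω) * ∫⁻ y, f p (Y ω, y) ∂ϖ) * ∏ q ∈ s, f q (Y ω, M q ω) ∂μ := by
          rw [h1]
          refine lintegral_congr fun ω => ?_
          rw [lintegral_const_mul _ (by fun_prop)]
          ring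
      _ = _ := by
          rw [ih (g := fun b => g b * ∫⁻ y, f p (b, y) ∂ϖ) (hg.mul (hf p).lintegral_prod_right')]
          simp_rw [Finset.prod_insert hp, mul_assoc]

open Classical in
lemma lintegral_expNeg_marks [Countable ι] (hY : Measurable Y) (hM : ∀ p, Measurable (M p))
    (hind : ∀ (s : Finset ι) (p : ι), p ∉ s → IndepFun (fun ω => (Y ω, fun q : s => M q ω)) (M p) μ)
    (hlaw : ∀ p, μ.map (M p) = ϖ) [IsProbabilityMeasure ϖ] {a : ι → β → Prop}
    (ha : ∀ p, MeasurableSet {b | a p b}) {f : ι → β × γ → ℝ≥0∞} (hf : ∀ p, Measurable (f p)) :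
    ∫⁻ ω, expNeg (∑' p, if a p (Y ω) then f p (Y ω, M p ω) else 0) ∂μ =
      ∫⁻ ω, expNeg (∑' p, if a p (Y ω) then
        negLog (∫⁻ y, expNeg (f p (Y ω, y)) ∂ϖ) else 0) ∂μ := by
  have hF : ∀ p, Measurable fun z : β × γ => if a p z.1 then f p z else 0 := fun p =>
    Measurable.ite (measurable_fst (ha p)) (hf p) measurable_const
  have hG : ∀ p, Measurable fun b : β => if a p b then
      negLog (∫⁻ y, expNeg (f p (b, y)) ∂ϖ) else 0 := fun p =>
    Measurable.ite (ha p) (measurable_negLog.comp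
      (measurable_expNeg.comp (hf p)).lintegral_prod_right') measurable_const
  have hlim : ∀ (u : ι → Ω → ℝ≥0∞), (∀ p, Measurable (u p)) →
      Tendsto (fun s : Finset ι => ∫⁻ ω, ∏ p ∈ s, expNeg (u p ω) ∂μ) atTop
        (𝓝 (∫⁻ ω, expNeg (∑' p, u p ω) ∂μ)) := fun u hu => by
    refine tendsto_lintegral_filter_of_dominated_convergence (fun _ => 1)
      (Eventually.of_forall fun s => Finset.measurable_prod _ fun p _ =>
        measurable_expNeg.comp (hu p))
      (Eventually.of_forall fun s => ae_of_all _ fun ω => ?_) (by simp)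
      (ae_of_all _ fun ω => ?_)
    · exact Finset.prod_le_one' fun p _ => expNeg_le_one _
    · simp_rw [← expNeg_sum]
      exact tendsto_expNeg_tsum _
  refine tendsto_nhds_unique (hlim (fun p ω => if a p (Y ω) then f p (Y ω, M p ω) else 0)
    fun p => (hF p).comp (hY.prodMk (hM p))) ?_
  have h := fun s => lintegral_prod_marks hY hM hind hlaw
    (fun p => measurable_expNeg.comp (hF p)) s (measurable_const (a := 1))
  simp only [one_mul, Function.comp_apply] at h
  simp_rw [h]
  refine (hlim (fun p ω => if a p (Y ω) then negLog (∫⁻ y, expNeg (f p (Y ω, y)) ∂ϖ) else 0)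
    fun p => (hG p).comp hY).congr fun s => lintegral_congr fun ω => Finset.prod_congr rfl
    fun p _ => ?_
  split_ifs
  · rw [expNeg_negLog]
    exact lintegral_le_const (ae_of_all _ fun y => expNeg_le_one _)
  · simp

end Marks

/-! ### The marked nodes of a network -/

namespace Network

variable {K : ℕ} {Ω : Type*} (X : Network K Ω)

/-- The point processes of a role. -/
def nodes (u : Role) (ω : Ω) : Fin (K + 1) → ℕ∞ × (ℕ → Plane) :=
  fun l => (X.number u l ω, fun n => X.point u l n ω)

/-- The marks of a link. -/
def mark (c₀ : Channel) (r t : End K) (ω : Ω) : ℝ × ℝ := (X.coin r t ω, X.gain c₀ r t ω)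

/-- σ-algebra generated by a set of sources of randomness. -/
@[reducible] def sigmaOf (S : Set (Source K)) : MeasurableSpace Ω := ⨆ i ∈ S, X.sigma i

/-- Layer, position and marks, with respect to the receiver `r`, of a transmitter. -/
def markedTx (c₀ : Channel) (r : End K) (p : Node K) (ω : Ω) : Fin (K + 1) × Plane × ℝ × ℝ :=
  (p.1, X.point .tx p.1 p.2 ω, X.mark c₀ r (some p) ω)

variable {X}

lemma sigma_le_sigmaOf {S : Set (Source K)} {i : Source K} (hi : i ∈ S) :
    X.sigma i ≤ X.sigmaOf S := le_iSup₂_of_le i hi le_rfl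

lemma measurable_number_sigmaOf {S : Set (Source K)} {u : Role} {l : Fin (K + 1)}
    (h : Source.nodes u l ∈ S) : Measurable[X.sigmaOf S] (X.number u l) :=
  Measurable.of_comap_le (le_sup_left.trans (sigma_le_sigmaOf (X := X) h))

lemma measurable_point_sigmaOf {S : Set (Source K)} {u : Role} {l : Fin (K + 1)}
    (h : Source.nodes u l ∈ S) (n : ℕ) : Measurable[X.sigmaOf S] (X.point u l n) :=
  Measurable.of_comap_le (((le_iSup
    (fun n => MeasurableSpace.comap (X.point u l n) inferInstance) n).trans le_sup_right).trans
    (sigma_le_sigmaOf (X := X) h))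

lemma measurable_coin_sigmaOf {S : Set (Source K)} {r t : End K}
    (h : Source.coin r t ∈ S) : Measurable[X.sigmaOf S] (X.coin r t) :=
  Measurable.of_comap_le (sigma_le_sigmaOf (X := X) h)

lemma measurable_gain_sigmaOf {S : Set (Source K)} {c₀ : Channel} {r t : End K}
    (h : Source.gain c₀ r t ∈ S) : Measurable[X.sigmaOf S] (X.gain c₀ r t) :=
  Measurable.of_comap_le (sigma_le_sigmaOf (X := X) h)

lemma measurable_nodes_sigmaOf {S : Set (Source K)} {u : Role}
    (h : ∀ l, Source.nodes u l ∈ S) : Measurable[X.sigmaOf S] (X.nodes u) := by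
  refine @measurable_pi_lambda _ _ _ (X.sigmaOf S) _ _ fun l => ?_
  refine Measurable.prodMk (measurable_number_sigmaOf (h l)) ?_
  exact @measurable_pi_lambda _ _ _ (X.sigmaOf S) _ _ fun n => measurable_point_sigmaOf (h l) n

lemma measurable_mark_sigmaOf {S : Set (Source K)} {c₀ : Channel} {r t : End K}
    (h : Source.coin r t ∈ S) (h' : Source.gain c₀ r t ∈ S) :
    Measurable[X.sigmaOf S] (X.mark c₀ r t) :=
  Measurable.prodMk (measurable_coin_sigmaOf h)
    (measurable_gain_sigmaOf h')

variable [MeasurableSpace Ω] {θ : Params K} {μ : Measure Ω}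

lemma IsModel.measurable_number (h : X.IsModel θ μ) (u : Role) (l : Fin (K + 1)) :
    Measurable (X.number u l) := (h.poisson u l).measurable_number

lemma IsModel.measurable_point (h : X.IsModel θ μ) (u : Role) (l : Fin (K + 1)) (n : ℕ) :
    Measurable (X.point u l n) := (h.poisson u l).measurable_point n

lemma IsModel.measurable_nodes (h : X.IsModel θ μ) (u : Role) : Measurable (X.nodes u) :=
  measurable_pi_lambda _ fun l => (h.measurable_number u l).prodMk
    (measurable_pi_lambda _ fun n => h.measurable_point u l n)

lemma IsModel.measurable_mark (h : X.IsModel θ μ) (c₀ : Channel) (r t : End K) :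
    Measurable (X.mark c₀ r t) := (h.measurable_coin r t).prodMk (h.measurable_gain c₀ r t)

lemma IsModel.sigma_le (h : X.IsModel θ μ) (i : Source K) : X.sigma i ≤ ‹MeasurableSpace Ω› := by
  cases i with
  | nodes u k =>
    refine sup_le (h.measurable_number u k).comap_le ?_
    exact iSup_le fun n => (h.measurable_point u k n).comap_le
  | coin r t => exact (h.measurable_coin r t).comap_le
  | gain c r t => exact (h.measurable_gain c r t).comap_le

lemma IsModel.indepFun_of_disjoint (h : X.IsModel θ μ) {S T : Set (Source K)} (hST : Disjoint S T)
    {β γ : Type*} [MeasurableSpace β] [MeasurableSpace γ] {Y : Ω → β} {W : Ω → γ}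
    (hY : Measurable[X.sigmaOf S] Y) (hW : Measurable[X.sigmaOf T] W) : IndepFun Y W μ := by
  rw [IndepFun_iff_Indep]
  exact indep_of_indep_of_le (indep_iSup_of_disjoint h.sigma_le h.indep hST)
    hY.comap_le hW.comap_le

/-- Law of the marks of a link. -/
noncomputable def markLaw (θ : Params K) (c₀ : Channel) : Measure (ℝ × ℝ) :=
  ((volume : Measure ℝ).restrict (Icc 0 1)).prod (gammaMeasure (θ.m c₀) (θ.m c₀))

instance (θ : Params K) (c₀ : Channel) :
    IsProbabilityMeasure (gammaMeasure (θ.m c₀) (θ.m c₀)) :=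
  isProbabilityMeasure_gammaMeasure (θ.m_pos c₀) (θ.m_pos c₀)

instance : IsProbabilityMeasure ((volume : Measure ℝ).restrict (Icc 0 1)) := ⟨by simp⟩

instance (θ : Params K) (c₀ : Channel) : IsProbabilityMeasure (markLaw θ c₀) := by
  unfold markLaw; infer_instance

lemma IsModel.map_mark (h : X.IsModel θ μ) [IsProbabilityMeasure μ] (c₀ : Channel) (r t : End K) :
    μ.map (X.mark c₀ r t) = markLaw θ c₀ := by
  have hind : IndepFun (X.coin r t) (X.gain c₀ r t) μ :=
    h.indepFun_of_disjoint (S := {Source.coin r t}) (T := {Source.gain c₀ r t}) (by simp)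
      (measurable_coin_sigmaOf (mem_singleton _)) (measurable_gain_sigmaOf (mem_singleton _))
  have h1 := (indepFun_iff_map_prod_eq_prod_map_map (h.measurable_coin r t).aemeasurable
    (h.measurable_gain c₀ r t).aemeasurable).1 hind
  rw [h.law_coin, h.law_gain] at h1
  exact h1

lemma IsModel.indepFun_marks (h : X.IsModel θ μ) (c₀ : Channel) (r : End K) (s : Finset (Node K))
    (p : Node K) (hp : p ∉ s) :
    IndepFun (fun ω => (X.nodes .tx ω, fun q : s => X.mark c₀ r (some (q : Node K)) ω))
      (X.mark c₀ r (some p)) μ := by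
  let S : Set (Source K) := {i | (∃ l, i = .nodes .tx l) ∨
    ∃ q ∈ s, i = .coin r (some q) ∨ i = .gain c₀ r (some q)}
  refine h.indepFun_of_disjoint (S := S) (T := {Source.coin r (some p), Source.gain c₀ r (some p)})
    ?_ ?_ ?_
  · rw [Set.disjoint_left]
    rintro i (⟨l, rfl⟩ | ⟨q, hq, rfl | rfl⟩) hi <;> simp at hi
    all_goals exact hp (hi ▸ hq)
  · refine Measurable.prodMk
      (measurable_nodes_sigmaOf fun l => Or.inl ⟨l, rfl⟩) ?_
    refine @measurable_pi_lambda _ _ _ (X.sigmaOf S) _ _ fun q => ?_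
    exact measurable_mark_sigmaOf (Or.inr ⟨q, q.2, Or.inl rfl⟩) (Or.inr ⟨q, q.2, Or.inr rfl⟩)
  · exact measurable_mark_sigmaOf (by simp) (by simp)

/-- Intensity of the marked transmitters. -/
noncomputable def txIntensity (θ : Params K) (c₀ : Channel) :
    Measure (Fin (K + 1) × Plane × ℝ × ℝ) :=
  Measure.sum fun l => ((θ.dens .tx l • (volume : Measure Plane)).prod (markLaw θ c₀)).map
    (Prod.mk l)

lemma lintegral_txIntensity (θ : Params K) (c₀ : Channel)
    {f : Fin (K + 1) × Plane × ℝ × ℝ → ℝ≥0∞} (hf : Measurable f) :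
    ∫⁻ z, f z ∂(txIntensity θ c₀) =
      ∑ l, (θ.dens .tx l : ℝ≥0∞) * ∫⁻ x, ∫⁻ m, f (l, x, m) ∂(markLaw θ c₀) := by
  rw [txIntensity, lintegral_sum_measure, tsum_fintype]
  refine Finset.sum_congr rfl fun l _ => ?_
  rw [lintegral_map hf measurable_prodMk_left,
    lintegral_prod (fun z => f (l, z)) (hf.comp measurable_prodMk_left).aemeasurable, lintegral_smul_measure]
  rfl

lemma IsModel.iIndepFun_nodes (h : X.IsModel θ μ) (u : Role) :
    iIndepFun (fun l ω => X.nodes u ω l) μ := by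
  rw [iIndepFun_iff_iIndep]
  refine iIndep_of_iIndep_of_le (h.indep.precomp (g := fun l => Source.nodes u l)
    fun l l' hl => by simpa using hl) fun l => ?_
  have h1 : Measurable[X.sigmaOf {Source.nodes u l}] fun ω => X.nodes u ω l := by
    refine Measurable.prodMk
      (measurable_number_sigmaOf (mem_singleton _)) ?_
    exact @measurable_pi_lambda _ _ _ (X.sigmaOf {Source.nodes u l}) _ _ fun n =>
      measurable_point_sigmaOf (mem_singleton _) n
  refine h1.comap_le.trans ?_
  simp [sigmaOf]

open Classical in
lemma IsModel.lintegral_expNeg_nodes (h : X.IsModel θ μ) [IsProbabilityMeasure μ] (u : Role)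
    {v : Fin (K + 1) → Plane → ℝ≥0∞} (hv : ∀ l, Measurable (v l)) :
    ∫⁻ ω, expNeg (∑' p : Node K, if X.Active u p ω then v p.1 (X.point u p.1 p.2 ω) else 0) ∂μ =
      expNeg (∑ l, (θ.dens u l : ℝ≥0∞) * ∫⁻ x, (1 - expNeg (v l x))) := by
  have hsplit : ∀ ω, expNeg (∑' p : Node K,
      if X.Active u p ω then v p.1 (X.point u p.1 p.2 ω) else 0) =
      ∏ l, expNeg (∑' n : ℕ, if (n : ℕ∞) < X.number u l ω then v l (X.point u l n ω) else 0) :=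
    fun ω => by
      rw [ENNReal.tsum_prod', tsum_fintype, expNeg_sum]
      refine Finset.prod_congr rfl fun l _ => ?_
      congr 1
      refine tsum_congr fun n => ?_
      by_cases hn : (n : ℕ∞) < X.number u l ω <;> simp [Active, hn]
  have hm : ∀ l, Measurable fun b : ℕ∞ × (ℕ → Plane) =>
      expNeg (∑' n : ℕ, if (n : ℕ∞) < b.1 then v l (b.2 n) else 0) := fun l =>
    measurable_expNeg.comp (Measurable.tsum fun n => Measurable.ite
      (measurable_fst (MeasurableSet.of_discrete (s := Ioi (n : ℕ∞))))
      ((hv l).comp (by fun_prop)) measurable_const)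
  simp_rw [hsplit]
  rw [lintegral_prod_eq_prod_lintegral_of_indepFun Finset.univ (fun l ω => expNeg (∑' n : ℕ,
    if (n : ℕ∞) < X.number u l ω then v l (X.point u l n ω) else 0))
    ((h.iIndepFun_nodes u).comp _ hm)
    fun l => (hm l).comp ((measurable_pi_apply l).comp (h.measurable_nodes u)), expNeg_sum]
  refine Finset.prod_congr rfl fun l _ => ?_
  rw [(h.poisson u l).laplaceFunctional (hv l), lintegral_smul_measure]
  rfl

/-- The marked transmitters form a Poisson process. -/
theorem IsModel.hasPoissonLaplace (h : X.IsModel θ μ) [IsProbabilityMeasure μ] (c₀ : Channel)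
    (r : End K) : HasPoissonLaplace (X.Active .tx) (X.markedTx c₀ r) (txIntensity θ c₀) μ where
  measurableSet_active p := h.measurable_number .tx p.1 (MeasurableSet.of_discrete
    (s := Ioi (p.2 : ℕ∞)))
  measurable_point p := measurable_const.prodMk ((h.measurable_point .tx p.1 p.2).prodMk
    (h.measurable_mark c₀ r (some p)))
  laplace v hv := by
    classical
    have hf : ∀ p : Node K, Measurable fun z : (Fin (K + 1) → ℕ∞ × (ℕ → Plane)) × ℝ × ℝ =>
        v (p.1, (z.1 p.1).2 p.2, z.2) := fun p =>
      hv.comp (measurable_const.prodMk (Measurable.prodMk (by fun_prop) measurable_snd))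
    have h1 := lintegral_expNeg_marks (μ := μ) (h.measurable_nodes .tx)
      (fun p : Node K => h.measurable_mark c₀ r (some p)) (h.indepFun_marks c₀ r)
      (fun p => h.map_mark c₀ r (some p)) (a := fun p b => (p.2 : ℕ∞) < (b p.1).1)
      (fun p => ((measurable_fst.comp (measurable_pi_apply p.1)) (MeasurableSet.of_discrete
        (s := Ioi (p.2 : ℕ∞))))) hf
    have hw : ∀ l, Measurable fun x => negLog (∫⁻ m, expNeg (v (l, x, m)) ∂(markLaw θ c₀)) :=
      fun l => measurable_negLog.comp
        ((measurable_expNeg.comp (hv.comp measurable_prodMk_left)).lintegral_prod_right')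
    refine Eq.trans ?_ (h1.trans ((h.lintegral_expNeg_nodes .tx hw).trans ?_))
    · refine lintegral_congr fun ω => ?_
      congr 1
    · congr 1
      rw [lintegral_txIntensity θ c₀ (f := fun z => 1 - expNeg (v z))
        (measurable_const.sub (measurable_expNeg.comp hv))]
      refine Finset.sum_congr rfl fun l _ => ?_
      congr 1
      refine lintegral_congr fun x => ?_
      have hle : ∫⁻ m, expNeg (v (l, x, m)) ∂(markLaw θ c₀) ≤ 1 :=
        lintegral_le_const (ae_of_all _ fun y => expNeg_le_one _)
      rw [expNeg_negLog hle, lintegral_sub (f := fun _ => 1) (g := fun m => expNeg (v (l, x, m)))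
        (measurable_expNeg.comp (hv.comp (by fun_prop))) (ne_top_of_le_ne_top ENNReal.one_ne_top hle) (ae_of_all _ fun y => expNeg_le_one _)]
      simp

end Network

end MAN

namespace MAN
open Filter Topology

/-! ### Integrals -/

lemma lintegral_fun_norm_plane {f : ℝ → ℝ≥0∞} (hf : Measurable f) :
    ∫⁻ x : Plane, f ‖x‖ = ENNReal.ofReal (2 * Real.pi) *
      ∫⁻ r in Ioi (0 : ℝ), ENNReal.ofReal r * f r := by
  have hm : Measurable fun p : ℝ × ℝ => f √(p.1 ^ 2 + p.2 ^ 2) := by fun_prop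
  have h1 : ∫⁻ x : Plane, f ‖x‖ = ∫⁻ y : Fin 2 → ℝ, f √(y 0 ^ 2 + y 1 ^ 2) := by
    rw [← (PiLp.volume_preserving_ofLp (Fin 2)).lintegral_comp (by fun_prop)]
    refine lintegral_congr fun x => ?_
    simp [EuclideanSpace.norm_eq, Fin.sum_univ_two]
  have h2 : ∫⁻ y : Fin 2 → ℝ, f √(y 0 ^ 2 + y 1 ^ 2) = ∫⁻ p : ℝ × ℝ, f √(p.1 ^ 2 + p.2 ^ 2) :=
    (volume_preserving_finTwoArrow ℝ).lintegral_comp hm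
  have h3 : ∀ p ∈ polarCoord.target, ENNReal.ofReal p.1 •
      (fun p : ℝ × ℝ => f √(p.1 ^ 2 + p.2 ^ 2)) (polarCoord.symm p) =
      (fun p : ℝ × ℝ => ENNReal.ofReal p.1 * f p.1) p := fun p hp => by
    rw [polarCoord_target] at hp
    have hp1 : 0 < p.1 := hp.1
    simp only [polarCoord_symm_apply, smul_eq_mul]
    congr 2
    rw [show (p.1 * Real.cos p.2) ^ 2 + (p.1 * Real.sin p.2) ^ 2 = p.1 ^ 2 by
      rw [mul_pow, mul_pow, ← mul_add, Real.cos_sq_add_sin_sq, mul_one], Real.sqrt_sq hp1.le]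
  rw [h1, h2, ← lintegral_comp_polarCoord_symm,
    setLIntegral_congr_fun polarCoord.open_target.measurableSet h3, polarCoord_target,
    Measure.volume_eq_prod, ← Measure.prod_restrict, lintegral_prod _ (by fun_prop)]
  simp only [lintegral_const, Measure.restrict_apply_univ, Real.volume_Ioo]
  rw [lintegral_mul_const _ (by fun_prop), mul_comm]
  congr 2
  ring

lemma lintegral_sqrt_sq_add_sq {h : ℝ} (hh : 0 ≤ h) (f : ℝ → ℝ≥0∞) :
    ∫⁻ r in Ioi (0 : ℝ), ENNReal.ofReal r * f √(r ^ 2 + h ^ 2) =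
      ∫⁻ x in Ioi h, ENNReal.ofReal x * f x := by
  have hpos : ∀ r ∈ Ioi (0 : ℝ), 0 < r ^ 2 + h ^ 2 := fun r hr => by
    have : (0 : ℝ) < r := hr
    positivity
  have himg : (fun r : ℝ => √(r ^ 2 + h ^ 2)) '' Ioi 0 = Ioi h := by
    ext x
    constructor
    · rintro ⟨r, hr, rfl⟩
      have : (0 : ℝ) < r := hr
      exact Real.lt_sqrt_of_sq_lt (by nlinarith)
    · intro hx
      have hx' : h < x := hx
      have hsq : 0 < x ^ 2 - h ^ 2 := by nlinarith
      refine ⟨√(x ^ 2 - h ^ 2), Real.sqrt_pos.2 hsq, ?_⟩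
      simp only
      rw [Real.sq_sqrt hsq.le, sub_add_cancel, Real.sqrt_sq (hh.trans hx'.le)]
  have hd : ∀ r ∈ Ioi (0 : ℝ), HasDerivWithinAt (fun r : ℝ => √(r ^ 2 + h ^ 2))
      (r / √(r ^ 2 + h ^ 2)) (Ioi 0) r := fun r hr => by
    have h1 : HasDerivAt (fun r : ℝ => r ^ 2 + h ^ 2) (2 * r) r := by
      simpa using (hasDerivAt_pow 2 r).add_const (h ^ 2)
    refine ((h1.sqrt (hpos r hr).ne').congr_deriv ?_).hasDerivWithinAt
    rw [mul_div_mul_left _ _ two_ne_zero]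
  have hinj : InjOn (fun r : ℝ => √(r ^ 2 + h ^ 2)) (Ioi 0) := fun r hr r' hr' heq => by
    have := (Real.sqrt_inj (hpos r hr).le (hpos r' hr').le).1 heq
    have hr0 : (0 : ℝ) < r := hr
    have hr0' : (0 : ℝ) < r' := hr'
    nlinarith
  rw [← himg, lintegral_image_eq_lintegral_abs_deriv_mul measurableSet_Ioi hd hinj]
  refine setLIntegral_congr_fun measurableSet_Ioi fun r hr => ?_
  have hr0 : (0 : ℝ) < r := hr
  have hs := Real.sqrt_pos.2 (hpos r hr)
  rw [← mul_assoc, ← ENNReal.ofReal_mul (abs_nonneg _), abs_of_pos (div_pos hr0 hs),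
    div_mul_cancel₀ _ hs.ne']

lemma lintegral_plane_dist {h : ℝ} (hh : 0 ≤ h) {f : ℝ → ℝ≥0∞} (hf : Measurable f) :
    ∫⁻ x : Plane, f √(‖x‖ ^ 2 + h ^ 2) = ENNReal.ofReal (2 * Real.pi) *
      ∫⁻ x in Ioi h, ENNReal.ofReal x * f x := by
  rw [← lintegral_sqrt_sq_add_sq hh,
    lintegral_fun_norm_plane (f := fun r => f √(r ^ 2 + h ^ 2)) (by fun_prop)]

/-- Laplace transform of a Gamma distribution. -/
lemma lintegral_exp_neg_mul_gammaMeasure {m b : ℝ} (hm : 0 < m) (hb : 0 ≤ b) :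
    ∫⁻ g, expNeg (ENNReal.ofReal (b * g)) ∂(gammaMeasure m m) =
      ENNReal.ofReal ((1 / (1 + b / m)) ^ m) := by
  have hmb : 0 < m + b := by linarith
  have hq : 1 / (1 + b / m) = m / (m + b) := by field_simp
  have hpdf : ∀ r, Measurable (gammaPDF m r) := fun r =>
    (measurable_gammaPDFReal m r).ennreal_ofReal
  rw [gammaMeasure, lintegral_withDensity_eq_lintegral_mul _ (hpdf m) (by fun_prop)]
  have key : ∀ g, (gammaPDF m m * fun g => expNeg (ENNReal.ofReal (b * g))) g =
      ENNReal.ofReal ((1 / (1 + b / m)) ^ m) * gammaPDF m (m + b) g := fun g => by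
    rw [Pi.mul_apply]
    rcases lt_or_ge g 0 with hg | hg
    · simp [gammaPDF_of_neg hg]
    · rw [gammaPDF_of_nonneg hg, gammaPDF_of_nonneg hg, expNeg_ofReal (by positivity),
        ← ENNReal.ofReal_mul' (Real.exp_pos _).le, ← ENNReal.ofReal_mul (by positivity), hq,
        Real.div_rpow hm.le hmb.le]
      congr 1
      have h1 : Real.exp (-((m + b) * g)) = Real.exp (-(m * g)) * Real.exp (-(b * g)) := by
        rw [← Real.exp_add]; congr 1; ring
      have h2 : (m + b) ^ m ≠ 0 := (Real.rpow_pos_of_pos hmb m).ne'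
      rw [h1]
      field_simp
  simp_rw [key]
  rw [lintegral_const_mul _ (hpdf (m + b)), lintegral_gammaPDF_eq_one hm hmb, mul_one]

namespace Network

variable {K : ℕ} (θ : Params K) (i k : Fin (K + 1)) (c₀ : Channel)

instance : DecidableEq Channel := fun a b => by
  cases a <;> cases b <;> first | exact isTrue rfl | exact isFalse (by simp)

/-- Link distance of a transmitter to a receiver of layer `i` at the origin. -/
noncomputable def txDist (z : Fin (K + 1) × Plane × ℝ × ℝ) : ℝ := √(‖z.2.1‖ ^ 2 + θ.hdiff i z.1 ^ 2)

open Classical in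
/-- Channel environment of a transmitter to a receiver of layer `i` at the origin. -/
noncomputable def txChannel (z : Fin (K + 1) × Plane × ℝ × ℝ) : Channel :=
  if z.2.2.1 < θ.ρLos i z.1 (txDist θ i z) then .los else .nlos

/-- The interference of a transmitter at a receiver of layer `i` at the origin. -/
noncomputable def txPower (z : Fin (K + 1) × Plane × ℝ × ℝ) : ℝ≥0∞ :=
  if z.1 = k ∧ txChannel θ i z = c₀ then
    ENNReal.ofReal (θ.P k * z.2.2.2 * txDist θ i z ^ (-θ.α c₀)) else 0

lemma measurable_uncurry_fin {n : ℕ} {β γ : Type*} [MeasurableSpace β] [MeasurableSpace γ]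
    {f : Fin n → β → γ} (hf : ∀ l, Measurable (f l)) : Measurable fun z : Fin n × β => f z.1 z.2 :=
  measurable_from_prod_countable_right hf

@[fun_prop]
lemma measurable_txDist : Measurable (txDist θ i) := by
  have h : Measurable fun z : Fin (K + 1) × Plane × ℝ × ℝ => θ.hdiff i z.1 :=
    (Measurable.of_discrete (f := fun l => θ.hdiff i l)).comp measurable_fst
  unfold txDist
  fun_prop

lemma measurableSet_txChannel (c : Channel) : MeasurableSet {z | txChannel θ i z = c} := by
  have h1 : Measurable fun z : Fin (K + 1) × ℝ => θ.ρLos i z.1 z.2 :=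
    measurable_uncurry_fin fun l => θ.ρLos_measurable i l
  have h2 : MeasurableSet {z : Fin (K + 1) × Plane × ℝ × ℝ |
      z.2.2.1 < θ.ρLos i z.1 (txDist θ i z)} :=
    measurableSet_lt (by fun_prop) (h1.comp (measurable_fst.prodMk (measurable_txDist θ i)))
  cases c with
  | los =>
    convert h2 using 1
    ext z
    simp [txChannel]
  | nlos =>
    convert h2.compl using 1
    ext z
    simp [txChannel]

@[fun_prop]
lemma measurable_txPower : Measurable (txPower θ i k c₀) := by
  refine Measurable.ite ((measurable_fst (measurableSet_singleton k)).inter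
    (measurableSet_txChannel θ i c₀)) ?_ measurable_const
  fun_prop

lemma ρ_nonneg (c : Channel) (i j : Fin (K + 1)) (x : ℝ) : 0 ≤ θ.ρ c i j x := by
  cases c with
  | los => exact θ.ρLos_nonneg i j x
  | nlos => exact sub_nonneg.2 (θ.ρLos_le_one i j x)

lemma measurable_ρ (c : Channel) (i j : Fin (K + 1)) : Measurable (θ.ρ c i j) := by
  cases c with
  | los => exact θ.ρLos_measurable i j
  | nlos => exact (θ.ρLos_measurable i j).const_sub 1

lemma volume_txChannel (x : Plane) (g : ℝ) :
    (volume : Measure ℝ).restrict (Icc 0 1) {u | txChannel θ i (k, x, u, g) = c₀} =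
      ENNReal.ofReal (θ.ρ c₀ i k (txDist θ i (k, x, 0, 0))) := by
  have hd : ∀ u, txDist θ i (k, x, u, g) = txDist θ i (k, x, 0, 0) := fun u => rfl
  set d := txDist θ i (k, x, 0, 0)
  have h0 := θ.ρLos_nonneg i k d
  have h1 := θ.ρLos_le_one i k d
  have hset : MeasurableSet {u : ℝ | txChannel θ i (k, x, u, g) = c₀} :=
    (by fun_prop : Measurable fun u : ℝ => (k, x, u, g)) (measurableSet_txChannel θ i c₀)
  rw [Measure.restrict_apply hset]
  cases c₀ with
  | los =>
    have : {u : ℝ | txChannel θ i (k, x, u, g) = .los} ∩ Icc 0 1 = Ico 0 (θ.ρLos i k d) := by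
      ext u
      simp only [txChannel, hd, mem_inter_iff, mem_ofPred_eq, mem_Icc, mem_Ico]
      by_cases hu : u < θ.ρLos i k d
      · simp [hu, (hu.trans_le h1).le]
      · simp [hu]
    rw [this]
    simp [Params.ρ]
  | nlos =>
    have : {u : ℝ | txChannel θ i (k, x, u, g) = .nlos} ∩ Icc 0 1 = Icc (θ.ρLos i k d) 1 := by
      ext u
      simp only [txChannel, hd, mem_inter_iff, mem_ofPred_eq, mem_Icc]
      by_cases hu : u < θ.ρLos i k d
      · simp [hu]
      · simp [hu, h0.trans (not_lt.1 hu), not_lt.1 hu]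
    rw [this]
    simp [Params.ρ]

/-- Probability weight of the interference of a transmitter at link distance `x`. -/
noncomputable def laplaceDeficit (s : ℝ≥0) (x : ℝ) : ℝ :=
  1 - (1 / (1 + s * θ.P k * x ^ (-θ.α c₀) / θ.m c₀)) ^ θ.m c₀

lemma measurable_laplaceDeficit (s : ℝ≥0) : Measurable (laplaceDeficit θ k c₀ s) := by
  unfold laplaceDeficit
  fun_prop

lemma lintegral_one_sub_expNeg_gain (s : ℝ≥0) {d : ℝ} (hd : 0 ≤ d) :
    ∫⁻ g, (1 - expNeg (s * ENNReal.ofReal (θ.P k * g * d ^ (-θ.α c₀))))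
      ∂(gammaMeasure (θ.m c₀) (θ.m c₀)) = ENNReal.ofReal (laplaceDeficit θ k c₀ s d) := by
  have hb : 0 ≤ s * θ.P k * d ^ (-θ.α c₀) := by
    have := θ.P_pos k
    positivity
  have h1 : ∀ g : ℝ, expNeg (s * ENNReal.ofReal (θ.P k * g * d ^ (-θ.α c₀))) =
      expNeg (ENNReal.ofReal (s * θ.P k * d ^ (-θ.α c₀) * g)) := fun g => by
    rw [← ENNReal.ofReal_coe_nnreal, ← ENNReal.ofReal_mul s.coe_nonneg]
    congr 2; ring
  have h2 := lintegral_exp_neg_mul_gammaMeasure (θ.m_pos c₀) hb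
  simp_rw [h1]
  rw [lintegral_sub (by fun_prop) (by rw [h2]; exact ENNReal.ofReal_ne_top)
    (ae_of_all _ fun g => expNeg_le_one _), h2, laplaceDeficit, ENNReal.ofReal_sub _
    (Real.rpow_nonneg (one_div_nonneg.2 (add_nonneg zero_le_one (div_nonneg hb (θ.m_pos c₀).le))) _)]
  simp

/-- The marked transmitters whose link distance exceeds `χ` contribute the integral of the
theorem. -/
theorem setLIntegral_txIntensity (s : ℝ≥0) (χ : ℝ) {T : Set (Fin (K + 1) × Plane × ℝ × ℝ)}
    (hT : MeasurableSet T) (hTχ : ∀ z, z.1 = k → txChannel θ i z = c₀ → 0 < txDist θ i z →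
      (z ∈ T ↔ χ < txDist θ i z)) :
    ∫⁻ z in T, (1 - expNeg (s * txPower θ i k c₀ z)) ∂(txIntensity θ c₀) =
      ENNReal.ofReal (2 * Real.pi * θ.dens .tx k) *
        ∫⁻ x in Ioi (max χ (θ.hdiff i k)),
          ENNReal.ofReal (x * θ.ρ c₀ i k x * laplaceDeficit θ k c₀ s x) := by
  classical
  have hm : Measurable fun z => 1 - expNeg (s * txPower θ i k c₀ z) := by fun_prop
  have hh : 0 ≤ θ.hdiff i k := abs_nonneg _
  let f : ℝ → ℝ≥0∞ := (Ioi χ).indicator fun d =>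
    ENNReal.ofReal (θ.ρ c₀ i k d * laplaceDeficit θ k c₀ s d)
  have hf : Measurable f :=
    ((measurable_ρ θ c₀ i k).mul (measurable_laplaceDeficit θ k c₀ s)).ennreal_ofReal.indicator
      measurableSet_Ioi
  have hinner : ∀ᵐ x : Plane, ∫⁻ y, T.indicator (fun z => 1 - expNeg (s * txPower θ i k c₀ z))
      (k, x, y) ∂(markLaw θ c₀) = f √(‖x‖ ^ 2 + θ.hdiff i k ^ 2) := by
    filter_upwards [Measure.ae_ne volume (0 : Plane)] with x hx
    have hd : 0 < √(‖x‖ ^ 2 + θ.hdiff i k ^ 2) := Real.sqrt_pos.2 (by positivity)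
    set d := √(‖x‖ ^ 2 + θ.hdiff i k ^ 2)
    have hdist : ∀ u g, txDist θ i (k, x, u, g) = d := fun u g => rfl
    have hval : ∀ y : ℝ × ℝ, T.indicator (fun z => 1 - expNeg (s * txPower θ i k c₀ z)) (k, x, y) =
        (Ioi χ).indicator (fun _ => {u : ℝ | txChannel θ i (k, x, u, 0) = c₀}.indicator 1 y.1 *
          (1 - expNeg (s * ENNReal.ofReal (θ.P k * y.2 * d ^ (-θ.α c₀))))) d := fun y => by
      have hch : txChannel θ i (k, x, y.1, 0) = txChannel θ i (k, x, y) := rfl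
      by_cases hc : txChannel θ i (k, x, y) = c₀
      · have hiff := hTχ (k, x, y) rfl hc hd
        have hmem : y.1 ∈ {u : ℝ | txChannel θ i (k, x, u, 0) = c₀} := hc
        rw [indicator_of_mem hmem]
        by_cases hχ : χ < d
        · rw [indicator_of_mem (hiff.2 hχ), indicator_of_mem (show d ∈ Ioi χ from hχ), txPower,
            if_pos ⟨rfl, hc⟩]
          simp [hdist]
        · rw [indicator_of_notMem (fun h => hχ (hiff.1 h)),
            indicator_of_notMem (show d ∉ Ioi χ from hχ)]
      · have hmem : y.1 ∉ {u : ℝ | txChannel θ i (k, x, u, 0) = c₀} := hc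
        have hp : txPower θ i k c₀ (k, x, y) = 0 := if_neg fun h => hc h.2
        rw [indicator_of_notMem hmem, indicator_apply, hp]
        simp
    have hset : MeasurableSet {u : ℝ | txChannel θ i (k, x, u, 0) = c₀} :=
      (by fun_prop : Measurable fun u : ℝ => (k, x, u, (0 : ℝ))) (measurableSet_txChannel θ i c₀)
    simp_rw [hval]
    by_cases hχ : d ∈ Ioi χ
    · simp only [indicator_of_mem hχ, f]
      rw [markLaw, lintegral_prod_mul
        (f := {u : ℝ | txChannel θ i (k, x, u, 0) = c₀}.indicator 1)
        (g := fun g => 1 - expNeg (s * ENNReal.ofReal (θ.P k * g * d ^ (-θ.α c₀))))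
        (measurable_one.indicator hset).aemeasurable (by fun_prop), lintegral_indicator_one hset, volume_txChannel,
        lintegral_one_sub_expNeg_gain θ k c₀ s hd.le, ← ENNReal.ofReal_mul (ρ_nonneg θ _ _ _ _)]
      rfl
    · simp [f, indicator_of_notMem hχ]
  rw [← lintegral_indicator hT, lintegral_txIntensity θ c₀ (hm.indicator hT),
    Finset.sum_eq_single k]
  · rw [lintegral_congr_ae hinner, lintegral_plane_dist hh hf, ← mul_assoc,
      mul_comm (2 * Real.pi), ENNReal.ofReal_mul (NNReal.coe_nonneg _), ENNReal.ofReal_coe_nnreal]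
    congr 1
    have hfx : ∀ x, ENNReal.ofReal x * f x = (Ioi χ).indicator (fun x => ENNReal.ofReal x *
        ENNReal.ofReal (θ.ρ c₀ i k x * laplaceDeficit θ k c₀ s x)) x := fun x => by
      by_cases hx : x ∈ Ioi χ <;> simp [f, hx]
    simp_rw [hfx]
    rw [setLIntegral_indicator measurableSet_Ioi, Ioi_inter_Ioi]
    refine setLIntegral_congr_fun measurableSet_Ioi fun x hx => ?_
    have hx0 : 0 ≤ x := hh.trans ((le_max_right _ _).trans (le_of_lt hx))
    rw [← ENNReal.ofReal_mul hx0, mul_assoc]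
  · intro l _ hl
    have : ∀ (x : Plane) (y : ℝ × ℝ),
        T.indicator (fun z => 1 - expNeg (s * txPower θ i k c₀ z)) (l, x, y) = 0 := fun x y => by
      have hp : txPower θ i k c₀ (l, x, y) = 0 := if_neg fun h => hl h.1
      rw [indicator_apply, hp]
      simp
    simp [this]
  · simp

end Network

end MAN

namespace MAN
open Filter Topology

lemma measurable_of_countable_cases {Ω ι β : Type*} [Countable ι] [MeasurableSpace β]
    {m : MeasurableSpace Ω} {T : Ω → ι} (hT : ∀ i, MeasurableSet {ω | T ω = i}) {f : ι → Ω → β}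
    (hf : ∀ i, Measurable (f i)) : Measurable fun ω => f (T ω) ω := by
  intro s hs
  have : (fun ω => f (T ω) ω) ⁻¹' s = ⋃ i, {ω | T ω = i} ∩ f i ⁻¹' s := by
    ext ω
    simp
  rw [this]
  exact MeasurableSet.iUnion fun i => (hT i).inter (hf i hs)

instance : Finite Channel :=
  Finite.of_surjective (fun b : Bool => if b then Channel.los else Channel.nlos) fun c => by
    cases c
    exacts [⟨true, rfl⟩, ⟨false, rfl⟩]

namespace Network

/-! ### Measurability -/

section Measurability

variable {K : ℕ} {Ω : Type*} {X : Network K Ω} {m : MeasurableSpace Ω} (θ : Params K)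

lemma measurable_pos {u : Role} (h : ∀ l n, Measurable (X.point u l n)) (e : End K) :
    Measurable (X.pos u e) := by
  cases e with
  | none => exact measurable_const
  | some p => exact h p.1 p.2

lemma measurable_dist {r t : End K} (hr : Measurable (X.pos .rx r)) (ht : Measurable (X.pos .tx t))
    (i j : Fin (K + 1)) : Measurable (X.dist θ i j r t) := by
  unfold dist
  fun_prop

lemma measurableSet_channel {i j : Fin (K + 1)} {r t : End K} (hc : Measurable (X.coin r t))
    (hd : Measurable (X.dist θ i j r t)) (c : Channel) :
    MeasurableSet {ω | X.channel θ i j r t ω = c} := by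
  have h : MeasurableSet {ω | X.coin r t ω < θ.ρLos (layer i r) (layer j t) (X.dist θ i j r t ω)} :=
    measurableSet_lt hc ((θ.ρLos_measurable _ _).comp hd)
  cases c with
  | los =>
    convert h using 1
    ext ω
    simp [channel]
  | nlos =>
    convert h.compl using 1
    ext ω
    simp [channel]

lemma measurable_candDist {o : Subject} (h : ∀ l n, Measurable (X.point (candidateRole o) l n))
    (i j : Fin (K + 1)) (p : Node K) : Measurable (X.candDist θ o i j p) := by
  cases o with
  | receiver => exact measurable_dist θ measurable_const (measurable_pos h _) i j
  | transmitter => exact measurable_dist θ (measurable_pos h _) measurable_const i j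

lemma measurable_score {o : Subject} (h : ∀ l n, Measurable (X.point (candidateRole o) l n))
    (hc : ∀ p, Measurable (X.coin (rxEnd o p) (txEnd o p))) (a : Criterion)
    (i j : Fin (K + 1)) (p : Node K) : Measurable (X.score θ o a i j p) := by
  have hd := measurable_candDist θ h i j p
  cases a with
  | nearest => exact hd.inv.const_mul _
  | strongest =>
    exact measurable_of_countable_cases (T := X.candChannel θ o i j p)
      (f := fun c ω => θ.B p.1 * X.candDist θ o i j p ω ^ (-θ.α c))
      (measurableSet_channel θ (hc p) hd) fun c => (hd.pow_const _).const_mul _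

lemma measurableSet_isAssociated {o : Subject} (hN : ∀ l, Measurable (X.number (candidateRole o) l))
    (h : ∀ l n, Measurable (X.point (candidateRole o) l n))
    (hc : ∀ p, Measurable (X.coin (rxEnd o p) (txEnd o p))) (a : Criterion)
    (i j : Fin (K + 1)) (p : Node K) : MeasurableSet {ω | X.IsAssociated θ o a i j p ω} := by
  have hA : ∀ q : Node K, MeasurableSet {ω | X.Active (candidateRole o) q ω} := fun q =>
    hN q.1 (MeasurableSet.of_discrete (s := Ioi (q.2 : ℕ∞)))
  refine (hA p).inter ?_
  have : {ω | ∀ q, X.Active (candidateRole o) q ω → q ≠ p →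
      X.score θ o a i j q ω < X.score θ o a i j p ω} =
      ⋂ q, {ω | X.Active (candidateRole o) q ω}ᶜ ∪ ({_ω | q = p} ∪
        {ω | X.score θ o a i j q ω < X.score θ o a i j p ω}) := by
    ext ω
    simp only [mem_ofPred_eq, mem_iInter, mem_union, mem_compl_iff]
    exact forall_congr' fun q => by tauto
  change MeasurableSet {ω | ∀ q, X.Active (candidateRole o) q ω → q ≠ p →
      X.score θ o a i j q ω < X.score θ o a i j p ω}
  rw [this]
  exact MeasurableSet.iInter fun q => (hA q).compl.union ((MeasurableSet.const _).union
    (measurableSet_lt (measurable_score θ h hc a i j q) (measurable_score θ h hc a i j p)))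

end Measurability

variable {K : ℕ} {Ω : Type*} {X : Network K Ω} {θ : Params K} {o : Subject} {a : Criterion}
  {i j k : Fin (K + 1)} {c c₀ : Channel}

lemma isAssociated_unique {p q : Node K} {ω : Ω} (hp : X.IsAssociated θ o a i j p ω)
    (hq : X.IsAssociated θ o a i j q ω) : p = q := by
  by_contra hne
  exact lt_asymm (hp.2 q hq.1 (Ne.symm hne)) (hq.2 p hp.1 hne)

lemma associated_eq_some_iff {p : Node K} {ω : Ω} :
    X.associated θ o a i j ω = some p ↔ X.IsAssociated θ o a i j p ω := by
  unfold associated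
  constructor
  · intro h
    split_ifs at h with hex
    exact Option.some_injective _ h ▸ hex.choose_spec
  · intro h
    have hex : ∃ p, X.IsAssociated θ o a i j p ω := ⟨p, h⟩
    rw [dif_pos hex, isAssociated_unique hex.choose_spec h]

lemma mainLinkDist_eq {p : Node K} {ω : Ω} (h : X.IsAssociated θ o a i j p ω) :
    X.mainLinkDist θ o a i j ω = X.candDist θ o i j p ω := by
  simp [mainLinkDist, associated_eq_some_iff.2 h]

lemma interference_eq {p : Node K} {ω : Ω} (h : X.IsAssociated θ o a i j p ω) :
    X.interference θ o a i j k c₀ ω =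
      X.interferenceAt θ i j k c₀ (rxEnd o p) (txEnd o p) ω := by
  simp [interference, associated_eq_some_iff.2 h]

lemma mem_mainLinkEvent_iff {ω : Ω} : ω ∈ X.mainLinkEvent θ o a i j c ↔
    ∃ p, X.IsAssociated θ o a i j p ω ∧ layer i (rxEnd o p) = i ∧ layer j (txEnd o p) = j ∧
      X.candChannel θ o i j p ω = c := by
  simp only [mainLinkEvent, associated_eq_some_iff]
  rfl

/-- The event that the main link has a given type and joins the typical node to `p`. -/
def linkEvent (X : Network K Ω) (θ : Params K) (o : Subject) (a : Criterion) (i j : Fin (K + 1))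
    (c : Channel) (p : Node K) : Set Ω :=
  {ω | X.IsAssociated θ o a i j p ω ∧ layer i (rxEnd o p) = i ∧ layer j (txEnd o p) = j ∧
      X.candChannel θ o i j p ω = c}

lemma mainLinkEvent_eq_iUnion :
    X.mainLinkEvent θ o a i j c = ⋃ p, X.linkEvent θ o a i j c p := by
  ext ω
  simp only [mem_mainLinkEvent_iff, mem_iUnion]
  rfl

variable [MeasurableSpace Ω] {μ : Measure Ω}

lemma IsModel.measurable_dist (h : X.IsModel θ μ) (i j : Fin (K + 1)) (r t : End K) :
    Measurable (X.dist θ i j r t) :=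
  Network.measurable_dist θ (measurable_pos (h.measurable_point .rx) r)
    (measurable_pos (h.measurable_point .tx) t) i j

lemma IsModel.measurableSet_channel (h : X.IsModel θ μ) (i j : Fin (K + 1)) (r t : End K)
    (c : Channel) : MeasurableSet {ω | X.channel θ i j r t ω = c} :=
  Network.measurableSet_channel θ (h.measurable_coin r t) (h.measurable_dist i j r t) c

lemma IsModel.measurableSet_active (h : X.IsModel θ μ) (u : Role) (p : Node K) :
    MeasurableSet {ω | X.Active u p ω} :=
  h.measurable_number u p.1 (MeasurableSet.of_discrete (s := Ioi (p.2 : ℕ∞)))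

lemma IsModel.measurableSet_isAssociated (h : X.IsModel θ μ) (o : Subject) (a : Criterion)
    (i j : Fin (K + 1)) (p : Node K) : MeasurableSet {ω | X.IsAssociated θ o a i j p ω} :=
  Network.measurableSet_isAssociated θ (h.measurable_number _) (h.measurable_point _)
    (fun _ => h.measurable_coin _ _) a i j p

lemma IsModel.measurableSet_associated (h : X.IsModel θ μ) (o : Subject) (a : Criterion)
    (i j : Fin (K + 1)) (q : Option (Node K)) :
    MeasurableSet {ω | X.associated θ o a i j ω = q} := by
  cases q with
  | some p =>
    simp_rw [associated_eq_some_iff]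
    exact h.measurableSet_isAssociated o a i j p
  | none =>
    have : {ω | X.associated θ o a i j ω = none} =
        (⋃ p, {ω | X.IsAssociated θ o a i j p ω})ᶜ := by
      ext ω
      simp only [mem_ofPred_eq, mem_compl_iff, mem_iUnion, ← associated_eq_some_iff (X := X)]
      cases X.associated θ o a i j ω <;> simp
    rw [this]
    exact (MeasurableSet.iUnion (h.measurableSet_isAssociated o a i j)).compl

lemma IsModel.measurableSet_linkEvent (h : X.IsModel θ μ) (p : Node K) :
    MeasurableSet (X.linkEvent θ o a i j c p) :=
  (h.measurableSet_isAssociated o a i j p).inter ((MeasurableSet.const _).inter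
    ((MeasurableSet.const _).inter (h.measurableSet_channel i j _ _ c)))

lemma IsModel.measurableSet_mainLinkEvent (h : X.IsModel θ μ) :
    MeasurableSet (X.mainLinkEvent θ o a i j c) := by
  rw [mainLinkEvent_eq_iUnion]
  exact MeasurableSet.iUnion fun p => h.measurableSet_linkEvent p

lemma IsModel.measurable_mainLinkDist (h : X.IsModel θ μ) :
    Measurable (X.mainLinkDist θ o a i j) := by
  refine measurable_of_countable_cases (T := X.associated θ o a i j)
    (f := fun q ω => match q with
      | none => (0 : ℝ)
      | some p => X.candDist θ o i j p ω) (h.measurableSet_associated o a i j) fun q => ?_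
  cases q with
  | none => exact measurable_const
  | some p => exact h.measurable_dist i j _ _

lemma IsModel.measurable_interferenceAt (h : X.IsModel θ μ) (r t : End K) :
    Measurable (X.interferenceAt θ i j k c₀ r t) := by
  have hd := fun n => h.measurable_dist i j r (some (k, n))
  have hg := fun n => h.measurable_gain c₀ r (some (k, n))
  refine Measurable.tsum fun n => Measurable.ite ((h.measurableSet_active .tx (k, n)).inter
    ((MeasurableSet.const _).inter (h.measurableSet_channel i j r _ c₀))) ?_ measurable_const
  exact (((hg n).const_mul _).mul ((hd n).pow_const _)).ennreal_ofReal

lemma IsModel.measurable_interference (h : X.IsModel θ μ) :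
    Measurable (X.interference θ o a i j k c₀) := by
  refine measurable_of_countable_cases (T := X.associated θ o a i j)
    (f := fun q ω => match q with
      | none => (0 : ℝ≥0∞)
      | some p => X.interferenceAt θ i j k c₀ (rxEnd o p) (txEnd o p) ω)
    (h.measurableSet_associated o a i j) fun q => ?_
  cases q with
  | none => exact measurable_const
  | some p => exact h.measurable_interferenceAt _ _

/-- The conditional Laplace transform of the interference. -/
noncomputable def interferenceLaplace (θ : Params K) (o : Subject) (a : Criterion)
    (i j k : Fin (K + 1)) (c c₀ : Channel) (s : ℝ≥0) (y : ℝ) : ℝ≥0∞ :=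
  expNeg (ENNReal.ofReal (2 * Real.pi * θ.dens .tx k) *
    ∫⁻ x in Ioi (max (θ.χ o a j k c c₀ y) (θ.hdiff i k)),
      ENNReal.ofReal (x * θ.ρ c₀ i k x * laplaceDeficit θ k c₀ s x))

end Network

end MAN

namespace MAN
open Filter Topology

lemma HasPoissonLaplace.ae_notMem {Ω E ι : Type*} [Countable ι] [MeasurableSpace Ω]
    [MeasurableSpace E] {a : ι → Ω → Prop} {Z : ι → Ω → E} {ν : Measure E} {μ : Measure Ω}
    [IsProbabilityMeasure μ] (h : HasPoissonLaplace a Z ν μ) {A : Set E} (hA : MeasurableSet A)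
    (hν : ν A = 0) : ∀ᵐ ω ∂μ, ∀ p, a p ω → Z p ω ∉ A := by
  classical
  have hm : Measurable (A.indicator fun _ => (∞ : ℝ≥0∞)) := measurable_const.indicator hA
  have h1 := h.laplace _ hm
  have h2 : ∫⁻ x, (1 - expNeg (A.indicator (fun _ => (∞ : ℝ≥0∞)) x)) ∂ν = 0 := by
    have : ∀ x, 1 - expNeg (A.indicator (fun _ => (∞ : ℝ≥0∞)) x) = A.indicator 1 x := fun x => by
      by_cases hx : x ∈ A <;> simp [hx]
    simp_rw [this]
    rw [lintegral_indicator_one hA, hν]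
  rw [h2, expNeg_zero] at h1
  have h3 := ae_eq_of_ae_le_of_lintegral_le (ae_of_all μ fun ω => expNeg_le_one
    (∑' p, if a p ω then A.indicator (fun _ => (∞ : ℝ≥0∞)) (Z p ω) else 0))
    (by rw [h1]; exact ENNReal.one_ne_top) (by fun_prop) (by rw [h1]; simp)
  filter_upwards [h3] with ω hω p hp hpA
  rw [ENNReal.tsum_eq_top_of_eq_top ⟨p, by simp [hp, hpA]⟩, expNeg_top] at hω
  exact zero_ne_one hω

namespace Network

variable {K : ℕ} (θ : Params K) (a : Criterion) (i j k : Fin (K + 1)) (c c₀ : Channel)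

/-- The score of a transmitter for a receiver of layer `i` at the origin. -/
noncomputable def txScore (z : Fin (K + 1) × Plane × ℝ × ℝ) : ℝ :=
  match a with
  | .nearest => θ.B z.1 * (txDist θ i z)⁻¹
  | .strongest => θ.B z.1 * txDist θ i z ^ (-θ.α (txChannel θ i z))

lemma measurable_txScore : Measurable (txScore θ a i) := by
  have hB : Measurable fun z : Fin (K + 1) × Plane × ℝ × ℝ => θ.B z.1 :=
    (Measurable.of_discrete (f := θ.B)).comp measurable_fst
  cases a with
  | nearest => exact hB.mul (measurable_txDist θ i).inv
  | strongest =>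
    exact measurable_of_countable_cases (T := txChannel θ i)
      (f := fun c z => θ.B z.1 * txDist θ i z ^ (-θ.α c))
      (measurableSet_txChannel θ i) fun c => hB.mul ((measurable_txDist θ i).pow_const _)

variable {θ a i}

lemma txScore_pos {z : Fin (K + 1) × Plane × ℝ × ℝ} (hz : 0 < txDist θ i z) :
    0 < txScore θ a i z := by
  have := θ.B_pos z.1
  cases a with
  | nearest => exact mul_pos this (inv_pos.2 hz)
  | strongest => exact mul_pos this (Real.rpow_pos_of_pos hz _)

lemma txDist_pos_of_txScore_pos {z : Fin (K + 1) × Plane × ℝ × ℝ} (hz : 0 < txScore θ a i z) :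
    0 < txDist θ i z := by
  refine (Real.sqrt_nonneg _ : 0 ≤ txDist θ i z).lt_of_ne fun h => hz.ne' ?_
  have h0 : txDist θ i z = 0 := h.symm
  cases a with
  | nearest => simp [txScore, h0]
  | strongest =>
    simp [txScore, h0, Real.zero_rpow (neg_ne_zero.2 (θ.α_pos (txChannel θ i z)).ne')]

lemma mul_inv_lt_mul_inv_iff {b b' x x' : ℝ} (hb' : 0 < b') (hx : 0 < x) (hx' : 0 < x') :
    b * x⁻¹ < b' * x'⁻¹ ↔ x' * b / b' < x := by
  rw [← div_eq_mul_inv, ← div_eq_mul_inv, div_lt_div_iff₀ hx hx', div_lt_iff₀ hb', mul_comm b,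
    mul_comm b']

lemma txScore_lt_iff {z w : Fin (K + 1) × Plane × ℝ × ℝ} (hz : 0 < txDist θ i z)
    (hw : 0 < txDist θ i w) : txScore θ a i z < txScore θ a i w ↔
      θ.χ .receiver a w.1 z.1 (txChannel θ i w) (txChannel θ i z) (txDist θ i w) <
        txDist θ i z := by
  cases a with
  | nearest => exact mul_inv_lt_mul_inv_iff (θ.B_pos _) hz hw
  | strongest =>
    simp only [txScore, Params.χ, Params.R]
    rw [Real.rpow_neg hz.le, Real.rpow_neg hw.le, mul_inv_lt_mul_inv_iff (θ.B_pos _)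
      (Real.rpow_pos_of_pos hz _) (Real.rpow_pos_of_pos hw _), one_div,
      Real.rpow_inv_lt_iff_of_pos _ hz.le (θ.α_pos _)]
    have := θ.B_pos z.1
    have := θ.B_pos w.1
    positivity

lemma exists_txDist_le (θ : Params K) (a : Criterion) (i : Fin (K + 1)) {t : ℝ} (ht : 0 < t) :
    ∃ ρ : ℝ, ∀ z, t ≤ txScore θ a i z → txDist θ i z ≤ ρ := by
  have hle : ∀ {b x : ℝ}, 0 < x → t ≤ b * x⁻¹ → x ≤ b / t := fun {b x} hx h => by
    rw [← div_eq_mul_inv, le_div_iff₀ hx] at h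
    rw [le_div_iff₀ ht]
    linarith
  have hpos : ∀ z, t ≤ txScore θ a i z → 0 < txDist θ i z := fun z hz =>
    txDist_pos_of_txScore_pos (ht.trans_le hz)
  cases a with
  | nearest =>
    obtain ⟨ρ, hρ⟩ := (Set.finite_range fun l => θ.B l / t).bddAbove
    exact ⟨ρ, fun z hz => (hle (hpos z hz) hz).trans (hρ ⟨z.1, rfl⟩)⟩
  | strongest =>
    obtain ⟨ρ, hρ⟩ := (Set.finite_range fun q : Fin (K + 1) × Channel =>
      (θ.B q.1 / t) ^ (θ.α q.2)⁻¹).bddAbove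
    refine ⟨ρ, fun z hz => le_trans ?_ (hρ ⟨(z.1, txChannel θ i z), rfl⟩)⟩
    have hd := hpos z hz
    simp only [txScore] at hz
    rw [Real.rpow_neg hd.le] at hz
    rw [Real.le_rpow_inv_iff_of_pos hd.le (div_nonneg (θ.B_pos _).le ht.le) (θ.α_pos _)]
    exact hle (Real.rpow_pos_of_pos hd _) hz

lemma txIntensity_apply (θ : Params K) (c₀ : Channel) {A : Set (Fin (K + 1) × Plane × ℝ × ℝ)}
    (s : Fin (K + 1) → Set Plane) (hs : ∀ l, MeasurableSet (s l))
    (hA : A ⊆ {z | z.2.1 ∈ s z.1}) :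
    txIntensity θ c₀ A ≤ ∑ l, (θ.dens .tx l : ℝ≥0∞) * volume (s l) := by
  have hm : MeasurableSet {z : Fin (K + 1) × Plane × ℝ × ℝ | z.2.1 ∈ s z.1} := by
    have : {z : Fin (K + 1) × Plane × ℝ × ℝ | z.2.1 ∈ s z.1} =
        ⋃ l, (Prod.fst ⁻¹' {l}) ∩ (fun z => z.2.1) ⁻¹' s l := by
      ext z; simp
    rw [this]
    exact MeasurableSet.iUnion fun l => (measurable_fst (measurableSet_singleton l)).inter
      ((by fun_prop : Measurable fun z : Fin (K + 1) × Plane × ℝ × ℝ => z.2.1) (hs l))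
  refine (measure_mono hA).trans_eq ?_
  rw [← lintegral_indicator_one hm, lintegral_txIntensity θ c₀ (measurable_one.indicator hm)]
  refine Finset.sum_congr rfl fun l _ => ?_
  congr 1
  rw [← lintegral_indicator_one (hs l)]
  refine lintegral_congr fun x => ?_
  by_cases hx : x ∈ s l <;> simp [hx]

lemma norm_le_txDist (z : Fin (K + 1) × Plane × ℝ × ℝ) : ‖z.2.1‖ ≤ txDist θ i z :=
  Real.le_sqrt_of_sq_le (by nlinarith [sq_nonneg (θ.hdiff i z.1)])

lemma txIntensity_le_txScore_ne_top {t : ℝ} (ht : 0 < t) :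
    txIntensity θ c₀ {z | t ≤ txScore θ a i z} ≠ ∞ := by
  obtain ⟨ρ, hρ⟩ := exists_txDist_le θ a i ht
  refine ne_top_of_le_ne_top ?_ (txIntensity_apply θ c₀ (fun _ => Metric.closedBall 0 ρ)
    (fun _ => measurableSet_closedBall) fun z hz => ?_)
  · exact ENNReal.sum_ne_top.2 fun l _ => ENNReal.mul_ne_top ENNReal.coe_ne_top
      measure_closedBall_lt_top.ne
  · simpa using (norm_le_txDist z).trans (hρ z hz)

lemma txIntensity_txDist_eq_zero : txIntensity θ c₀ {z | txDist θ i z = 0} = 0 := by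
  refine le_antisymm ((txIntensity_apply θ c₀ (fun _ => {0})
    (fun _ => measurableSet_singleton _) fun z hz => ?_).trans (by simp)) zero_le
  have := norm_le_txDist (θ := θ) (i := i) z
  rw [show txDist θ i z = 0 from hz] at this
  simpa using this

section Receiver

variable {Ω : Type*} {X : Network K Ω}

lemma candDist_receiver (p : Node K) (ω : Ω) :
    X.candDist θ .receiver i j p ω = txDist θ i (X.markedTx c₀ none p ω) := by
  simp [candDist, dist, rxEnd, txEnd, pos, layer, txDist, markedTx]

lemma dist_none_some (p : Node K) (ω : Ω) :
    X.dist θ i j none (some p) ω = txDist θ i (X.markedTx c₀ none p ω) :=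
  candDist_receiver j c₀ p ω

lemma channel_none_some (p : Node K) (ω : Ω) :
    X.channel θ i j none (some p) ω = txChannel θ i (X.markedTx c₀ none p ω) := by
  simp only [channel, txChannel, dist_none_some j c₀]
  rfl

lemma score_receiver (p : Node K) (ω : Ω) :
    X.score θ .receiver a i j p ω = txScore θ a i (X.markedTx c₀ none p ω) := by
  simp only [score, txScore, candDist_receiver j c₀, candChannel, rxEnd, txEnd,
    channel_none_some j c₀]
  rfl

open Classical in
lemma interferenceAt_receiver (p : Node K) (ω : Ω) :
    X.interferenceAt θ i j k c₀ none (some p) ω =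
      sumOthers (X.Active .tx) (X.markedTx c₀ none) (txPower θ i k c₀) p ω := by
  rw [interferenceAt, sumOthers, ENNReal.tsum_prod', tsum_eq_single k]
  · refine tsum_congr fun n => ?_
    simp only [channel_none_some j c₀, dist_none_some j c₀, txPower, ne_eq, Option.some.injEq]
    have hk : (X.markedTx c₀ none (k, n) ω).1 = k := rfl
    by_cases h1 : X.Active .tx (k, n) ω <;> by_cases h2 : (k, n) = p <;>
      by_cases h3 : txChannel θ i (X.markedTx c₀ none (k, n) ω) = c₀ <;> simp [h1, h2, h3, hk]
    rfl
  · intro l hl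
    refine ENNReal.tsum_eq_zero.2 fun n => ?_
    have : txPower θ i k c₀ (X.markedTx c₀ none (l, n) ω) = 0 := if_neg fun h => hl h.1
    simp [this]

lemma isTop_iff {S : Set ℝ} {p : Node K} {ω : Ω} :
    IsTop (X.Active .tx) (X.markedTx c₀ none)
      {z | z.1 = j ∧ txChannel θ i z = c ∧ txDist θ i z ∈ S} (txScore θ a i) p ω ↔
    ω ∈ X.linkEvent θ .receiver a i j c p ∧ X.mainLinkDist θ .receiver a i j ω ∈ S ∧
      0 < txScore θ a i (X.markedTx c₀ none p ω) := by
  have h1 : X.IsAssociated θ .receiver a i j p ω ↔ X.Active .tx p ω ∧ ∀ q, X.Active .tx q ω →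
      q ≠ p → txScore θ a i (X.markedTx c₀ none q ω) <
        txScore θ a i (X.markedTx c₀ none p ω) := by
    simp only [IsAssociated, candidateRole, score_receiver j c₀]
  constructor
  · rintro ⟨hp, ⟨hj, hc, hS⟩, h0, hq⟩
    have ha := h1.2 ⟨hp, hq⟩
    refine ⟨⟨ha, rfl, hj, (channel_none_some j c₀ p ω).trans hc⟩, ?_, h0⟩
    rwa [mainLinkDist_eq ha, candDist_receiver j c₀]
  · rintro ⟨⟨ha, -, hj, hc⟩, hS, h0⟩
    rw [mainLinkDist_eq ha, candDist_receiver j c₀] at hS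
    exact ⟨(h1.1 ha).1, ⟨hj, (channel_none_some j c₀ p ω).symm.trans hc, hS⟩, h0, (h1.1 ha).2⟩

variable [MeasurableSpace Ω] {μ : Measure Ω} [IsProbabilityMeasure μ]

theorem IsModel.setLIntegral_receiver (h : X.IsModel θ μ) (s : ℝ≥0) {S : Set ℝ}
    (hS : MeasurableSet S) :
    ∫⁻ ω in X.mainLinkEvent θ .receiver a i j c ∩ X.mainLinkDist θ .receiver a i j ⁻¹' S,
        expNeg (s * X.interference θ .receiver a i j k c₀ ω) ∂μ =
      ∫⁻ ω in X.mainLinkEvent θ .receiver a i j c ∩ X.mainLinkDist θ .receiver a i j ⁻¹' S,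
        interferenceLaplace θ .receiver a i j k c c₀ s (X.mainLinkDist θ .receiver a i j ω) ∂μ := by
  classical
  have hL := h.hasPoissonLaplace c₀ none
  have hσ := measurable_txScore θ a i
  set A : Set (Fin (K + 1) × Plane × ℝ × ℝ) :=
    {z | z.1 = j ∧ txChannel θ i z = c ∧ txDist θ i z ∈ S} with hAdef
  have hA : MeasurableSet A := (measurable_fst (measurableSet_singleton j)).inter
    ((measurableSet_txChannel θ i c).inter (measurable_txDist θ i hS))
  have hcost : Measurable fun z => s * txPower θ i k c₀ z := by fun_prop
  have hE : MeasurableSet (X.mainLinkEvent θ .receiver a i j c ∩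
      X.mainLinkDist θ .receiver a i j ⁻¹' S) :=
    h.measurableSet_mainLinkEvent.inter (h.measurable_mainLinkDist hS)
  have hpos : ∀ᵐ ω ∂μ, ∀ p, X.Active .tx p ω → 0 < txScore θ a i (X.markedTx c₀ none p ω) := by
    filter_upwards [hL.ae_notMem (measurable_txDist θ i (measurableSet_singleton 0))
      (txIntensity_txDist_eq_zero (θ := θ) (i := i) c₀)] with ω hω p hp
    exact txScore_pos ((Real.sqrt_nonneg _).lt_of_ne fun h0 => hω p hp h0.symm)
  have hmem : ∀ᵐ ω ∂μ, ω ∈ X.mainLinkEvent θ .receiver a i j c ∩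
      X.mainLinkDist θ .receiver a i j ⁻¹' S ↔
      ∃ p, IsTop (X.Active .tx) (X.markedTx c₀ none) A (txScore θ a i) p ω := by
    filter_upwards [hpos] with ω hω
    simp only [hAdef, isTop_iff]
    constructor
    · rintro ⟨h1, h2⟩
      obtain ⟨p, hp⟩ := mem_mainLinkEvent_iff.1 h1
      exact ⟨p, hp, h2, hω p hp.1.1⟩
    · rintro ⟨p, hp, h2, -⟩
      exact ⟨mem_mainLinkEvent_iff.2 ⟨p, hp⟩, h2⟩
  rw [← lintegral_indicator hE, ← lintegral_indicator hE]
  refine Eq.trans ?_ ((hL.lintegral_maxSum hA hσ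
    (fun t ht => txIntensity_le_txScore_ne_top c₀ ht) hcost).trans ?_)
  · refine lintegral_congr_ae ?_
    filter_upwards [hmem] with ω hω
    by_cases hT : ∃ p, IsTop (X.Active .tx) (X.markedTx c₀ none) A (txScore θ a i) p ω
    · rw [indicator_of_mem (hω.2 hT)]
      obtain ⟨p, hp⟩ := hT
      rw [maxSum_eq_of_isTop (L := id) (fun _ _ => le_rfl) hp, id, if_pos hp.2.2.1, mul_one,
        interference_eq (isTop_iff j c c₀ |>.1 hp).1.1]
      simp only [rxEnd, txEnd]
      rw [interferenceAt_receiver, sumOthers, sumOthers, ← ENNReal.tsum_mul_left]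
      congr 1
      refine tsum_congr fun q => ?_
      split_ifs with hq
      · rw [levelCost, if_pos (hp.2.2.2 q hq.1 hq.2)]
      · simp
    · rw [indicator_of_notMem (fun h' => hT (hω.1 h')),
        maxSum_eq_zero (L := id) (fun _ _ => le_rfl) hT]
  · refine lintegral_congr_ae ?_
    filter_upwards [hmem] with ω hω
    by_cases hT : ∃ p, IsTop (X.Active .tx) (X.markedTx c₀ none) A (txScore θ a i) p ω
    · rw [indicator_of_mem (hω.2 hT)]
      obtain ⟨p, hp⟩ := hT
      have hz : sumOthers (X.Active .tx) (X.markedTx c₀ none)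
          (levelCost (txScore θ a i) (fun _ => 0) (txScore θ a i (X.markedTx c₀ none p ω))) p ω =
          0 := by
        refine ENNReal.tsum_eq_zero.2 fun q => ?_
        split_ifs with hq
        · rw [levelCost, if_pos (hp.2.2.2 q hq.1 hq.2)]
        · rfl
      have hd := txDist_pos_of_txScore_pos hp.2.2.1
      rw [maxSum_eq_of_isTop (L := id) (fun _ _ => le_rfl) hp, id, if_pos hp.2.2.1, hz,
        expNeg_zero, one_mul, mainLinkDist_eq (isTop_iff j c c₀ |>.1 hp).1.1,
        candDist_receiver j c₀, belowLaplace, interferenceLaplace]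
      congr 1
      refine setLIntegral_txIntensity θ i k c₀ s _ (hσ measurableSet_Iio) fun z hzk hzc hzd => ?_
      have := txScore_lt_iff (a := a) hzd hd
      rw [hp.2.1.1, hp.2.1.2.1, hzk, hzc] at this
      exact this
    · rw [indicator_of_notMem (fun h' => hT (hω.1 h')),
        maxSum_eq_zero (L := id) (fun _ _ => le_rfl) hT]

end Receiver

end Network

end MAN

namespace MAN
open Filter Topology

namespace Network

variable {K : ℕ} {θ : Params K} {a : Criterion} {i : Fin (K + 1)} (j k : Fin (K + 1))
  (c c₀ : Channel)

/-- Translation of the horizontal position. -/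
def translate (y : Plane) (z : Fin (K + 1) × Plane × ℝ × ℝ) : Fin (K + 1) × Plane × ℝ × ℝ :=
  (z.1, z.2.1 - y, z.2.2)

lemma measurable_translate (y : Plane) : Measurable (translate (K := K) y) := by
  unfold translate
  fun_prop

lemma lintegral_translate (y : Plane) {f : Fin (K + 1) × Plane × ℝ × ℝ → ℝ≥0∞} (hf : Measurable f) :
    ∫⁻ z, f (translate y z) ∂(txIntensity θ c₀) = ∫⁻ z, f z ∂(txIntensity θ c₀) := by
  rw [lintegral_txIntensity θ c₀ hf,
    lintegral_txIntensity θ c₀ (f := fun z => f (translate y z)) (hf.comp (measurable_translate y))]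
  refine Finset.sum_congr rfl fun l _ => ?_
  congr 1
  exact lintegral_sub_right_eq_self (μ := (volume : Measure Plane))
    (fun x => ∫⁻ m, f (l, x, m) ∂(markLaw θ c₀)) y

variable {Ω : Type*} {X : Network K Ω}

lemma dist_some_some (p q : Node K) (hp : p.1 = i) (ω : Ω) :
    X.dist θ i j (some p) (some q) ω =
      txDist θ i (translate (X.point .rx p.1 p.2 ω) (X.markedTx c₀ (some p) q ω)) := by
  simp [dist, pos, layer, txDist, translate, markedTx, hp, norm_sub_rev]

lemma channel_some_some (p q : Node K) (hp : p.1 = i) (ω : Ω) :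
    X.channel θ i j (some p) (some q) ω =
      txChannel θ i (translate (X.point .rx p.1 p.2 ω) (X.markedTx c₀ (some p) q ω)) := by
  simp only [channel, txChannel, dist_some_some j c₀ p q hp, layer, hp]
  rfl

open Classical in
lemma interferenceAt_transmitter (p : Node K) (hp : p.1 = i) (ω : Ω) :
    X.interferenceAt θ i j k c₀ (some p) none ω = ∑' q, if X.Active .tx q ω then
      txPower θ i k c₀ (translate (X.point .rx p.1 p.2 ω) (X.markedTx c₀ (some p) q ω)) else 0 := by
  rw [interferenceAt, ENNReal.tsum_prod', tsum_eq_single k]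
  · refine tsum_congr fun n => ?_
    have hk : (translate (X.point .rx p.1 p.2 ω) (X.markedTx c₀ (some p) (k, n) ω)).1 = k := rfl
    simp only [channel_some_some j c₀ p _ hp, dist_some_some j c₀ p _ hp, txPower]
    by_cases h1 : X.Active .tx (k, n) ω <;>
      by_cases h3 : txChannel θ i (translate (X.point .rx p.1 p.2 ω)
        (X.markedTx c₀ (some p) (k, n) ω)) = c₀ <;> simp [h1, h3, hk]
    rfl
  · intro l hl
    refine ENNReal.tsum_eq_zero.2 fun n => ?_
    have : txPower θ i k c₀
        (translate (X.point .rx p.1 p.2 ω) (X.markedTx c₀ (some p) (l, n) ω)) = 0 :=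
      if_neg fun h => hl h.1
    simp [this]

variable [MeasurableSpace Ω] {μ : Measure Ω} [IsProbabilityMeasure μ]

open Classical in
lemma IsModel.lintegral_expNeg_translate (h : X.IsModel θ μ) (s : ℝ≥0) (r : End K) (y₀ : Plane)
    (y : ℝ) :
    ∫⁻ ω, expNeg (s * ∑' q, if X.Active .tx q ω then
      txPower θ i k c₀ (translate y₀ (X.markedTx c₀ r q ω)) else 0) ∂μ =
      interferenceLaplace θ .transmitter a i j k c c₀ s y := by
  have hm : Measurable fun z => s * txPower θ i k c₀ (translate y₀ z) :=
    ((measurable_txPower θ i k c₀).comp (measurable_translate y₀)).const_mul _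
  have h1 := (h.hasPoissonLaplace c₀ r).laplace _ hm
  have h2 := setLIntegral_txIntensity θ i k c₀ s 0 MeasurableSet.univ
    (fun z _ _ hz => by simp [hz])
  rw [setLIntegral_univ] at h2
  rw [lintegral_translate c₀ y₀ (f := fun z => 1 - expNeg (s * txPower θ i k c₀ z))
    (by fun_prop), h2] at h1
  rw [interferenceLaplace, Params.χ, ← h1]
  refine lintegral_congr fun ω => ?_
  rw [← ENNReal.tsum_mul_left]
  simp_rw [mul_ite, mul_zero]

theorem IsModel.setLIntegral_linkEvent_transmitter (h : X.IsModel θ μ) (s : ℝ≥0) {S : Set ℝ}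
    (hS : MeasurableSet S) (p : Node K) :
    ∫⁻ ω in X.linkEvent θ .transmitter a i j c p ∩ X.candDist θ .transmitter i j p ⁻¹' S,
        expNeg (s * X.interferenceAt θ i j k c₀ (some p) none ω) ∂μ =
      ∫⁻ ω in X.linkEvent θ .transmitter a i j c p ∩ X.candDist θ .transmitter i j p ⁻¹' S,
        interferenceLaplace θ .transmitter a i j k c c₀ s (X.candDist θ .transmitter i j p ω) ∂μ := by
  classical
  by_cases hp : p.1 = i
  swap
  · have : X.linkEvent θ .transmitter a i j c p = ∅ := by
      ext ω
      simp [linkEvent, layer, rxEnd, hp]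
    simp [this]
  let 𝓢 : Set (Source K) := {σ | (∃ l, σ = .nodes .rx l) ∨ ∃ q : Node K, σ = .coin (some q) none}
  let 𝓣 : Set (Source K) := {σ | (∃ l, σ = .nodes .tx l) ∨
    ∃ q : Node K, σ = .coin (some p) (some q) ∨ σ = .gain c₀ (some p) (some q)}
  have hdisj : Disjoint 𝓢 𝓣 := by
    rw [Set.disjoint_left]
    rintro σ (⟨l, rfl⟩ | ⟨q, rfl⟩) (⟨l', h'⟩ | ⟨q', h' | h'⟩) <;> simp at h'
  set E := X.linkEvent θ .transmitter a i j c p ∩ X.candDist θ .transmitter i j p ⁻¹' S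
  have hN : ∀ l, Measurable[X.sigmaOf 𝓢] (X.number .rx l) := fun l =>
    measurable_number_sigmaOf (Or.inl ⟨l, rfl⟩)
  have hP : ∀ l n, Measurable[X.sigmaOf 𝓢] (X.point .rx l n) := fun l n =>
    measurable_point_sigmaOf (Or.inl ⟨l, rfl⟩) n
  have hC : ∀ q : Node K, Measurable[X.sigmaOf 𝓢] (X.coin (some q) none) := fun q =>
    measurable_coin_sigmaOf (Or.inr ⟨q, rfl⟩)
  have hD : Measurable[X.sigmaOf 𝓢] (X.candDist θ .transmitter i j p) :=
    measurable_candDist (o := .transmitter) θ hP i j p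
  have hE𝓢 : MeasurableSet[X.sigmaOf 𝓢] E :=
    MeasurableSet.inter (MeasurableSet.inter
      (Network.measurableSet_isAssociated (o := .transmitter) θ hN hP hC a i j p)
      (MeasurableSet.inter (MeasurableSet.const _) (MeasurableSet.inter (MeasurableSet.const _)
        (Network.measurableSet_channel θ (hC p) hD c)))) (hD hS)
  have hE : MeasurableSet E := (iSup₂_le fun σ _ => h.sigma_le σ : X.sigmaOf 𝓢 ≤ _) _ hE𝓢
  let U : Ω → ℝ≥0∞ × Plane := fun ω => (E.indicator 1 ω, X.point .rx p.1 p.2 ω)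
  let V : Ω → (Fin (K + 1) → ℕ∞ × (ℕ → Plane)) × (Node K → ℝ × ℝ) := fun ω =>
    (X.nodes .tx ω, fun q => X.mark c₀ (some p) (some q) ω)
  have hU𝓢 : Measurable[X.sigmaOf 𝓢] U :=
    Measurable.prodMk (Measurable.indicator measurable_const hE𝓢) (hP p.1 p.2)
  have hV𝓣 : Measurable[X.sigmaOf 𝓣] V := by
    refine Measurable.prodMk (measurable_nodes_sigmaOf fun l => Or.inl ⟨l, rfl⟩) ?_
    refine @measurable_pi_lambda _ _ _ (X.sigmaOf 𝓣) _ _ fun q => ?_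
    exact measurable_mark_sigmaOf (Or.inr ⟨q, Or.inl rfl⟩) (Or.inr ⟨q, Or.inr rfl⟩)
  have hUV : IndepFun U V μ := h.indepFun_of_disjoint hdisj hU𝓢 hV𝓣
  have hU : Measurable U :=
    (measurable_one.indicator hE).prodMk (h.measurable_point .rx p.1 p.2)
  have hV : Measurable V := (h.measurable_nodes .tx).prodMk
    (measurable_pi_lambda _ fun q => h.measurable_mark c₀ (some p) (some q))
  let f : (ℝ≥0∞ × Plane) × (Fin (K + 1) → ℕ∞ × (ℕ → Plane)) × (Node K → ℝ × ℝ) → ℝ≥0∞ := fun w =>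
    w.1.1 * expNeg (s * ∑' q : Node K, if (q.2 : ℕ∞) < (w.2.1 q.1).1 then
      txPower θ i k c₀ (translate w.1.2 (q.1, (w.2.1 q.1).2 q.2, w.2.2 q)) else 0)
  have hf : Measurable f := by
    refine Measurable.mul (by fun_prop) (measurable_expNeg.comp (Measurable.const_mul
      (Measurable.tsum fun q => Measurable.ite ?_ ((measurable_txPower θ i k c₀).comp ?_)
        measurable_const) _))
    · exact (by fun_prop : Measurable fun w : (ℝ≥0∞ × Plane) ×
        (Fin (K + 1) → ℕ∞ × (ℕ → Plane)) × (Node K → ℝ × ℝ) => (w.2.1 q.1).1)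
        (MeasurableSet.of_discrete (s := Ioi (q.2 : ℕ∞)))
    · unfold translate
      fun_prop
  have hfV : ∀ (e : ℝ≥0∞) (y : Plane) (ω : Ω), f ((e, y), V ω) =
      e * expNeg (s * ∑' q, if X.Active .tx q ω then
        txPower θ i k c₀ (translate y (X.markedTx c₀ (some p) q ω)) else 0) := fun e y ω => by
    simp only [f, V]
    congr 3
    refine tsum_congr fun q => ?_
    by_cases hq : (q.2 : ℕ∞) < X.number .tx q.1 ω
    · simp only [nodes, Active, hq, if_true]
      rfl
    · simp [nodes, Active, hq]
  have key := lintegral_of_indepFun hU hV hUV hf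
  rw [← lintegral_indicator hE, ← lintegral_indicator hE]
  refine Eq.trans (lintegral_congr fun ω => ?_) (key.trans (lintegral_congr fun ω => ?_))
  · rw [hfV]
    by_cases hω : ω ∈ E <;> simp [hω, interferenceAt_transmitter j k c₀ p hp]
  · rw [lintegral_map (f := fun v => f (U ω, v)) (hf.comp measurable_prodMk_left) hV]
    simp only [U, hfV]
    have hm : Measurable fun ω' => expNeg (s * ∑' q, if X.Active .tx q ω' then
        txPower θ i k c₀ (translate (X.point .rx p.1 p.2 ω) (X.markedTx c₀ (some p) q ω'))
        else 0) := by
      refine measurable_expNeg.comp (Measurable.const_mul (measurable_tsum_active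
        (h.hasPoissonLaplace c₀ (some p)).measurableSet_active
        (h.hasPoissonLaplace c₀ (some p)).measurable_point
        (v := fun z => txPower θ i k c₀ (translate (X.point .rx p.1 p.2 ω) z)) ?_) _)
      exact (measurable_txPower θ i k c₀).comp (measurable_translate _)
    rw [lintegral_const_mul _ hm, h.lintegral_expNeg_translate (a := a) j k c c₀ s (some p) _
      (X.candDist θ .transmitter i j p ω)]
    by_cases hω : ω ∈ E <;> simp [hω]

theorem IsModel.setLIntegral_transmitter (h : X.IsModel θ μ) (s : ℝ≥0) {S : Set ℝ}
    (hS : MeasurableSet S) :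
    ∫⁻ ω in X.mainLinkEvent θ .transmitter a i j c ∩ X.mainLinkDist θ .transmitter a i j ⁻¹' S,
        expNeg (s * X.interference θ .transmitter a i j k c₀ ω) ∂μ =
      ∫⁻ ω in X.mainLinkEvent θ .transmitter a i j c ∩ X.mainLinkDist θ .transmitter a i j ⁻¹' S,
        interferenceLaplace θ .transmitter a i j k c c₀ s
          (X.mainLinkDist θ .transmitter a i j ω) ∂μ := by
  have hE : ∀ p, MeasurableSet (X.linkEvent θ .transmitter a i j c p ∩
      X.candDist θ .transmitter i j p ⁻¹' S) := fun p =>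
    (h.measurableSet_linkEvent p).inter (h.measurable_dist i j _ _ hS)
  have hunion : X.mainLinkEvent θ .transmitter a i j c ∩
      X.mainLinkDist θ .transmitter a i j ⁻¹' S =
      ⋃ p, X.linkEvent θ .transmitter a i j c p ∩ X.candDist θ .transmitter i j p ⁻¹' S := by
    rw [mainLinkEvent_eq_iUnion, iUnion_inter]
    refine iUnion_congr fun p => ?_
    ext ω
    refine and_congr_right fun hω => ?_
    rw [mem_preimage, mem_preimage, mainLinkDist_eq hω.1]
  have hdisj : Pairwise (Function.onFun Disjoint fun p =>
      X.linkEvent θ .transmitter a i j c p ∩ X.candDist θ .transmitter i j p ⁻¹' S) :=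
    fun p q hpq => Set.disjoint_left.2 fun ω hω hω' =>
      hpq (isAssociated_unique hω.1.1 hω'.1.1)
  rw [hunion, lintegral_iUnion hE hdisj, lintegral_iUnion hE hdisj]
  refine tsum_congr fun p => ?_
  refine Eq.trans ?_ ((h.setLIntegral_linkEvent_transmitter (a := a) (i := i) j k c c₀ s hS p).trans ?_)
  · refine setLIntegral_congr_fun (hE p) fun ω hω => ?_
    rw [interference_eq hω.1.1]
    rfl
  · refine setLIntegral_congr_fun (hE p) fun ω hω => ?_
    rw [mainLinkDist_eq hω.1.1]

end Network

end MAN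

namespace MAN
open Filter Topology

/-! ### Conditional laws and their Laplace transforms -/

lemma tendsto_laplace {κ : Measure ℝ≥0∞} [IsFiniteMeasure κ] {u : ℕ → ℝ≥0} {s : ℝ≥0} (hs : s ≠ 0)
    (hu : Tendsto u atTop (𝓝 s)) : Tendsto (fun n => laplace κ (u n)) atTop (𝓝 (laplace κ s)) := by
  refine tendsto_lintegral_of_dominated_convergence (fun _ => 1)
    (fun n => measurable_expNeg.comp (measurable_id.const_mul _))
    (fun n => ae_of_all _ fun v => expNeg_le_one _) (by simp) (ae_of_all _ fun v => ?_)
  exact (continuous_expNeg.tendsto _).comp (ENNReal.Tendsto.mul_const (ENNReal.tendsto_coe.2 hu)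
    (Or.inl (by simpa using hs)))

lemma setLIntegral_laplace_condDistrib {Ω : Type*} [MeasurableSpace Ω] {μ : Measure Ω}
    [IsFiniteMeasure μ] {I : Ω → ℝ≥0∞} {D : Ω → ℝ} (hI : Measurable I) (hD : Measurable D) (s : ℝ≥0)
    {S : Set ℝ} (hS : MeasurableSet S) :
    ∫⁻ y in S, laplace (condDistrib I D μ y) s ∂(μ.map D) =
      ∫⁻ ω in D ⁻¹' S, expNeg (s * I ω) ∂μ := by
  have hf : Measurable fun w : ℝ × ℝ≥0∞ => expNeg (s * w.2) :=
    measurable_expNeg.comp (measurable_snd.const_mul _)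
  have h1 := Measure.setLIntegral_compProd (μ := μ.map D) (κ := condDistrib I D μ) hf hS
    MeasurableSet.univ
  simp only [Measure.restrict_univ] at h1
  rw [compProd_map_condDistrib hI.aemeasurable, setLIntegral_map (hS.prod MeasurableSet.univ) hf
    (hD.prodMk hI)] at h1
  simp only [laplace, ← h1]
  congr 2
  ext ω
  simp

namespace Network

variable {K : ℕ} {θ : Params K} {o : Subject} {a : Criterion} {i j k : Fin (K + 1)}
  {c c₀ : Channel}

lemma laplaceDeficit_mono {s t : ℝ≥0} (hst : s ≤ t) {x : ℝ} (hx : 0 ≤ x) :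
    laplaceDeficit θ k c₀ s x ≤ laplaceDeficit θ k c₀ t x := by
  have := θ.P_pos k
  have := θ.m_pos c₀
  unfold laplaceDeficit
  gcongr

lemma continuous_laplaceDeficit {x : ℝ} (hx : 0 ≤ x) :
    Continuous fun s : ℝ≥0 => laplaceDeficit θ k c₀ s x := by
  have := θ.P_pos k
  have hm := θ.m_pos c₀
  refine continuous_const.sub (Continuous.rpow_const (Continuous.div continuous_const
    (by fun_prop) fun s => ?_) fun s => Or.inr hm.le)
  positivity

lemma tendsto_interferenceLaplace {u : ℕ → ℝ≥0} {s : ℝ≥0} (hu : Tendsto u atTop (𝓝 s))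
    (hmono : Monotone u) (y : ℝ) :
    Tendsto (fun n => interferenceLaplace θ o a i j k c c₀ (u n) y) atTop
      (𝓝 (interferenceLaplace θ o a i j k c c₀ s y)) := by
  refine (continuous_expNeg.tendsto _).comp (ENNReal.Tendsto.const_mul ?_
    (Or.inr ENNReal.ofReal_ne_top))
  have hx : ∀ᵐ x ∂(volume : Measure ℝ).restrict (Ioi (max (θ.χ o a j k c c₀ y) (θ.hdiff i k))),
      0 ≤ x := by
    filter_upwards [ae_restrict_mem measurableSet_Ioi] with x hx
    exact (abs_nonneg _).trans ((le_max_right _ _).trans (le_of_lt hx))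
  refine lintegral_tendsto_of_tendsto_of_monotone (fun n => ?_) ?_ ?_
  · exact ((measurable_id.mul (measurable_ρ θ c₀ i k)).mul
      (measurable_laplaceDeficit θ k c₀ (u n))).ennreal_ofReal.aemeasurable
  · filter_upwards [hx] with x hx n n' hn
    exact ENNReal.ofReal_le_ofReal (mul_le_mul_of_nonneg_left (laplaceDeficit_mono (hmono hn) hx)
      (mul_nonneg hx (ρ_nonneg θ _ _ _ _)))
  · filter_upwards [hx] with x hx
    exact ENNReal.tendsto_ofReal
      ((((continuous_laplaceDeficit hx).tendsto s).comp hu).const_mul _)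

lemma measurable_χ : Measurable (θ.χ o a j k c c₀) := by
  cases o with
  | receiver =>
    cases a with
    | nearest => exact (measurable_id.mul_const _).div_const _
    | strongest => exact (((measurable_id.pow_const _).mul_const _).div_const _).pow_const _
  | transmitter => exact measurable_const

lemma measurable_interferenceLaplace (s : ℝ≥0) :
    Measurable (interferenceLaplace θ o a i j k c c₀ s) := by
  have hf : Measurable fun x => ENNReal.ofReal (x * θ.ρ c₀ i k x * laplaceDeficit θ k c₀ s x) :=
    ((measurable_id.mul (measurable_ρ θ c₀ i k)).mul
      (measurable_laplaceDeficit θ k c₀ s)).ennreal_ofReal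
  refine measurable_expNeg.comp (Measurable.const_mul ?_ _)
  simp_rw [← lintegral_indicator measurableSet_Ioi]
  refine Measurable.lintegral_prod_right' (f := fun w : ℝ × ℝ =>
    (Ioi (max (θ.χ o a j k c c₀ w.1) (θ.hdiff i k))).indicator
      (fun x => ENNReal.ofReal (x * θ.ρ c₀ i k x * laplaceDeficit θ k c₀ s x)) w.2) ?_
  exact (hf.comp measurable_snd).indicator (measurableSet_lt
    ((measurable_χ.comp measurable_fst).max measurable_const) measurable_snd)

variable {Ω : Type*} [MeasurableSpace Ω] {X : Network K Ω} {μ : Measure Ω} [IsProbabilityMeasure μ]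

lemma IsModel.setLIntegral_expNeg_interference (h : X.IsModel θ μ) (s : ℝ≥0) {S : Set ℝ}
    (hS : MeasurableSet S) :
    ∫⁻ ω in X.mainLinkEvent θ o a i j c ∩ X.mainLinkDist θ o a i j ⁻¹' S,
        expNeg (s * X.interference θ o a i j k c₀ ω) ∂μ =
      ∫⁻ ω in X.mainLinkEvent θ o a i j c ∩ X.mainLinkDist θ o a i j ⁻¹' S,
        interferenceLaplace θ o a i j k c c₀ s (X.mainLinkDist θ o a i j ω) ∂μ := by
  cases o with
  | receiver => exact h.setLIntegral_receiver j k c c₀ s hS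
  | transmitter => exact h.setLIntegral_transmitter j k c c₀ s hS

lemma IsModel.laplace_condInterferenceLaw_ae_eq (h : X.IsModel θ μ) (s : ℝ≥0) :
    ∀ᵐ y ∂((μ[|X.mainLinkEvent θ o a i j c]).map (X.mainLinkDist θ o a i j)),
      laplace (X.condInterferenceLaw θ μ o a i j k c c₀ y) s =
        interferenceLaplace θ o a i j k c c₀ s y := by
  have hD : Measurable (X.mainLinkDist θ o a i j) := h.measurable_mainLinkDist
  have hI : Measurable (X.interference θ o a i j k c₀) := h.measurable_interference
  refine ae_eq_of_forall_setLIntegral_eq_of_sigmaFinite ?_ (measurable_interferenceLaplace s)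
    fun S hS _ => ?_
  · exact Measurable.lintegral_kernel (measurable_expNeg.comp (measurable_id.const_mul _))
  · rw [condInterferenceLaw, setLIntegral_laplace_condDistrib hI hD s hS,
      setLIntegral_map hS (measurable_interferenceLaplace s) hD, ProbabilityTheory.cond,
      Measure.restrict_smul, lintegral_smul_measure, lintegral_smul_measure,
      Measure.restrict_restrict (hD hS), inter_comm, h.setLIntegral_expNeg_interference s hS]

end Network

end MAN

theorem lemma2 {K : ℕ} {Ω : Type*} [MeasurableSpace Ω] (μ : Measure Ω) [IsProbabilityMeasure μ]
    (θ : MAN.Params K) (X : MAN.Network K Ω) (hX : X.IsModel θ μ)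
    (o : MAN.Subject) (a : MAN.Criterion) (i j k : Fin (K + 1)) (c c₀ : MAN.Channel) :
    MeasurableSet (X.mainLinkEvent θ o a i j c) ∧
    Measurable (X.mainLinkDist θ o a i j) ∧
    Measurable (X.interference θ o a i j k c₀) ∧
    ∀ᵐ y ∂((μ[|X.mainLinkEvent θ o a i j c]).map (X.mainLinkDist θ o a i j)), ∀ s : ℝ≥0,
      MAN.laplace (X.condInterferenceLaw θ μ o a i j k c c₀ y) s =
        MAN.expNeg (ENNReal.ofReal (2 * Real.pi * θ.dens .tx k) *
          ∫⁻ x in Ioi (max (θ.χ o a j k c c₀ y) (θ.hdiff i k)),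
            ENNReal.ofReal (x * θ.ρ c₀ i k x *
              (1 - (1 / (1 + s * θ.P k * x ^ (-θ.α c₀) / θ.m c₀)) ^ θ.m c₀))) := by
  have hD : Measurable (X.mainLinkDist θ o a i j) := hX.measurable_mainLinkDist
  refine ⟨hX.measurableSet_mainLinkEvent, hD, hX.measurable_interference, ?_⟩
  obtain ⟨T, hTc, hTd⟩ := TopologicalSpace.exists_countable_dense ℝ≥0
  filter_upwards [(ae_ball_iff (hTc.insert 0)).2 fun s _ =>
    hX.laplace_condInterferenceLaw_ae_eq (o := o) (a := a) (i := i) (j := j) (k := k) (c := c)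
      (c₀ := c₀) s] with y hy s
  rcases eq_or_ne s 0 with rfl | hs
  · exact hy 0 (mem_insert 0 T)
  obtain ⟨u, hu, huT, hlim⟩ := hTd.exists_seq_strictMono_tendsto_of_lt hs.bot_lt
  have : IsFiniteMeasure (X.condInterferenceLaw θ μ o a i j k c c₀ y) := by
    unfold MAN.Network.condInterferenceLaw
    infer_instance
  refine tendsto_nhds_unique ((MAN.tendsto_laplace hs hlim).congr fun n => ?_)
    (MAN.Network.tendsto_interferenceLaplace hlim hu.monotone y)
  exact hy (u n) (mem_insert_of_mem 0 (huT n).2)
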